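/- Model. An input is a collection of $n$ distinct elements of a totally ordered set. The order can be observed only through unreliable comparisons: a comparison of two distinct elements reports the wrong result with probability at most $p$, where $p\in[0,\frac12)$ is a fixed constant; all comparison faults are independent, also for repeated comparisons of the same pair. Algorithms are randomized programs on a word RAM with words of $O(\log n)$ bits; each elementary instruction (arithmetic, memory access, branching, drawing a uniform integer from $\{0,\dots,a-1\}$, one unreliable comparison) takes one unit of time. $\mathrm{FT\text{-}Min}(k)$ is the problem of returning one of the smallest $k$ elements of the input. Write $\log$ for the base-two logarithm, and let $c_p=\left\lceil \frac{4(1-p)}{(1-2p)^2}\right\rceil$. Knockout tournament. Let $n=2^h$. Sample $n$ contestants independently and uniformly, with replacement, from the $n$ input elements. In round $i=1,\dots,h$ the $n/2^{i-1}$ remaining contestants are matched in pairs, and the winner of each match is the contestant that is reported to be smaller by the majority of $2c_p2^i+5$ independent comparisons. The contestant left after round $h$ is the winner of the tournament. Theorem. Fix $p\in[0,\frac12)$. The constants hidden in the $O$-notation depend only on $p$. (1) For every power of two $n\ge 1$, the probability that the winner of the tournament on $n$ elements is not one of the smallest $\frac34 n$ elements is at most $2^{-(n+1)}$. (2) There is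 an algorithm that, for every power of two $n\ge 2$, returns the winner of the tournament in $O(n\log n)$ worst-case time. Hence it solves $\mathrm{FT\text{-}Min}(\frac34 n)$ with failure probability at most $2^{-(n+1)}$. (3) There is an algorithm that, for all integers $n\ge 2$ and $1\le k\le n$, solves $\mathrm{FT\text{-}Min}(k)$ with probability at least $1-\frac1n$ in $$O\!\left(\frac nk\log n+(\log n)\log\log n\right)$$ worst-case time. If $\frac34 n$ is not an integer, "the smallest $\frac34 n$ elements" means the smallest $\lceil\frac34 n\rceil$ elements. -/

import Mathlib

open scoped ENNReal

universe u

noncomputable section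

namespace FTMin

/-! ### Inputs and unreliable comparisons -/

/-- A biased coin: `true` with probability `e`, `false` with probability `1 - e`. -/
def coin (e : unitInterval) : PMF Bool :=
  PMF.ofFintype (fun b => cond b (ENNReal.ofReal e) (ENNReal.ofReal (1 - e))) (by
    have h0 : (0 : ℝ) ≤ e := e.2.1
    have h1 : (0 : ℝ) ≤ 1 - e := sub_nonneg.2 e.2.2
    rw [Fintype.sum_bool]
    simp only [cond_true, cond_false]
    rw [← ENNReal.ofReal_add h0 h1]
    simp)

/-- A collection of `n` distinct elements of a linearly ordered type (the true order, which an
algorithm cannot see), together with the fault probabilities of the comparisons: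
a comparison of the `i`-th with the `j`-th element reports the wrong result with probability
`err i j ≤ p`. The case of a constant fault probability is `err i j = p`. -/
structure Input (α : Type u) [LinearOrder α] (n : ℕ) (p : ℝ) where
  /-- the elements -/
  key : Fin n → α
  key_injective : Function.Injective key
  /-- the fault probabilities -/
  err : Fin n → Fin n → unitInterval
  err_le : ∀ i j, (err i j : ℝ) ≤ p

section Inputs

variable {α : Type u} [LinearOrder α] {n : ℕ} {p : ℝ}

/-- The `i`-th element is one of the smallest `k` elements. -/
def Input.IsSmall (I : Input α n p) (k : ℕ) (i : Fin n) : Prop :=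
  (Finset.univ.filter fun j => I.key j < I.key i).card < k

/-- One unreliable comparison of the elements at positions `i` and `j`; the outcome `true` stands
for the report "the element at `i` is smaller than the element at `j`".
Two copies of the same element are never reported to be in this relation. -/
def Input.report (I : Input α n p) (i j : Fin n) : PMF Bool :=
  if i = j then PMF.pure false
  else (coin (I.err i j)).map fun wrong => xor wrong (decide (I.key i < I.key j))

/-! ### The knockout tournament -/

/-- The number of reports "`i` is smaller than `j`" among `N` independent comparisons. -/
def Input.votes (I : Input α n p) (i j : Fin n) : ℕ → PMF ℕ
  | 0 => PMF.pure 0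
  | N + 1 => (I.report i j).bind fun b => (I.votes i j N).map fun v => v + b.toNat

/-- The element reported to be smaller by the majority of `N` independent comparisons. -/
def Input.majority (I : Input α n p) (N : ℕ) (i j : Fin n) : PMF (Fin n) :=
  (I.votes i j N).map fun v => if N < 2 * v then i else j

/-- The constant `c_p` of the majority strategy: for `t > 0`, the majority of `2 c_p t + 1`
comparisons is correct with probability at least `1 - e ^ (-t)`. -/
def boostConst (p : ℝ) : ℕ := ⌈4 * (1 - p) / (1 - 2 * p) ^ 2⌉₊

/-- The number of comparisons of a match in the `i`-th round of the tournament. -/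
def matchLength (p : ℝ) (i : ℕ) : ℕ := 2 * boostConst p * 2 ^ i + 5

/-- The `i`-th round: the contestants are matched in pairs, and the winners are returned. -/
def Input.playRound (I : Input α n p) (i : ℕ) : List (Fin n) → PMF (List (Fin n))
  | x :: y :: l =>
    (I.majority (matchLength p i) x y).bind fun w => (I.playRound i l).map fun r => w :: r
  | l => PMF.pure l

/-- The `r` consecutive rounds `i, i + 1, …, i + r - 1`. -/
def Input.playRounds (I : Input α n p) : ℕ → ℕ → List (Fin n) → PMF (List (Fin n))
  | _, 0, l => PMF.pure l
  | i, r + 1, l => (I.playRound i l).bind (I.playRounds (i + 1) r)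

/-- `N` independent uniform samples, with replacement, from the `n` positions. -/
def samples (n : ℕ) [NeZero n] : ℕ → PMF (List (Fin n))
  | 0 => PMF.pure []
  | N + 1 => (PMF.uniformOfFintype (Fin n)).bind fun x => (samples n N).map fun l => x :: l

/-- The winner of the knockout tournament with `h` rounds, that is, among `2 ^ h` contestants
sampled with replacement. (After the last round exactly one contestant is left.) -/
def Input.knockout [NeZero n] (I : Input α n p) (h : ℕ) : PMF (Fin n) :=
  ((samples n (2 ^ h)).bind (I.playRounds 1 h)).map fun l => l.headD 0

end Inputs

/-! ### Randomized word RAM programs with unreliable comparisons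

A program has registers and a memory, both indexed by natural numbers and holding words of
`w` bits. The input elements are not words: they are accessed only through the comparison
instruction, by their positions `0, …, n - 1`. Every elementary step takes one unit of time. -/

/-- An operand: the content of a register, or a constant of the program. -/
inductive Operand
  | reg (r : ℕ)
  | lit (v : ℕ)

/-- The arithmetic operations (subtraction is truncated at zero, division is rounded down). -/
inductive Arith
  | add
  | sub
  | mul
  | div

/-- Programs. -/
inductive Cmd
  /-- no operation -/
  | skip
  /-- register `d` becomes the result of an arithmetic operation -/
  | arith (d : ℕ) (o : Arith) (a b : Operand)
  /-- register `d` becomes the memory cell with address `a` -/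
  | load (d : ℕ) (a : Operand)
  /-- the memory cell with address `a` becomes `b` -/
  | store (a b : Operand)
  /-- register `d` becomes a uniformly random element of `{0, …, a - 1}` (and `0` if `a = 0`) -/
  | random (d : ℕ) (a : Operand)
  /-- an unreliable comparison of the input elements at positions `a` and `b`; register `d`
  becomes `1` if the element at `a` is reported to be smaller and `0` otherwise -/
  | cmp (d : ℕ) (a b : Operand)
  /-- sequential composition -/
  | seq (c₁ c₂ : Cmd)
  /-- if `a < b` then `c₁` else `c₂` -/
  | ifLt (a b : Operand) (c₁ c₂ : Cmd)
  /-- while `a < b` repeat `c` -/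
  | whileLt (a b : Operand) (c : Cmd)

def Arith.eval : Arith → ℕ → ℕ → ℕ
  | .add, x, y => x + y
  | .sub, x, y => x - y
  | .mul, x, y => x * y
  | .div, x, y => x / y

/-- Contents of the registers and of the memory. -/
structure State where
  reg : ℕ → ℕ
  mem : ℕ → ℕ

def Operand.eval (s : State) : Operand → ℕ
  | .reg r => s.reg r
  | .lit v => v

/-- Write a value, truncated to `w` bits, into a register. -/
def State.setReg (w : ℕ) (s : State) (d v : ℕ) : State :=
  { s with reg := Function.update s.reg d (v % 2 ^ w) }

/-- Write a value, truncated to `w` bits, into a memory cell. -/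
def State.setMem (w : ℕ) (s : State) (a v : ℕ) : State :=
  { s with mem := Function.update s.mem a (v % 2 ^ w) }

/-- A configuration: the commands that remain to be executed, in order, and the state. -/
abbrev Config := List Cmd × State

/-- The outcome of the instruction `random`. -/
def draw (a : ℕ) : PMF ℕ :=
  if h : a = 0 then PMF.pure 0
  else
    haveI : NeZero a := ⟨h⟩
    (PMF.uniformOfFintype (Fin a)).map Fin.val

section Semantics

variable {α : Type u} [LinearOrder α] {n : ℕ} {p : ℝ}

/-- The outcome of the instruction `cmp` (always `0` for positions that are out of range). -/
def Input.answer (I : Input α n p) (a b : ℕ) : PMF ℕ :=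
  if h : a < n ∧ b < n then (I.report ⟨a, h.1⟩ ⟨b, h.2⟩).map Bool.toNat
  else PMF.pure 0

/-- One elementary step with words of `w` bits. All random choices and all comparison faults are
independent. A program without remaining commands has halted. -/
def step (w : ℕ) (I : Input α n p) : Config → PMF Config
  | ([], s) => PMF.pure ([], s)
  | (.skip :: K, s) => PMF.pure (K, s)
  | (.arith d o a b :: K, s) => PMF.pure (K, s.setReg w d (o.eval (a.eval s) (b.eval s)))
  | (.load d a :: K, s) => PMF.pure (K, s.setReg w d (s.mem (a.eval s)))
  | (.store a b :: K, s) => PMF.pure (K, s.setMem w (a.eval s) (b.eval s))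
  | (.random d a :: K, s) => (draw (a.eval s)).map fun v => (K, s.setReg w d v)
  | (.cmp d a b :: K, s) =>
    (I.answer (a.eval s) (b.eval s)).map fun v => (K, s.setReg w d v)
  | (.seq c₁ c₂ :: K, s) => PMF.pure (c₁ :: c₂ :: K, s)
  | (.ifLt a b c₁ c₂ :: K, s) =>
    PMF.pure ((if a.eval s < b.eval s then c₁ else c₂) :: K, s)
  | (.whileLt a b c :: K, s) =>
    PMF.pure (if a.eval s < b.eval s then c :: .whileLt a b c :: K else K, s)

/-- The random configuration after `T` steps. -/
def run (w : ℕ) (I : Input α n p) : ℕ → Config → PMF Config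
  | 0, c => PMF.pure c
  | T + 1, c => (step w I c).bind (run w I T)

/-- At the start, register `0` holds `n`, register `1` holds `k`, all else is `0`. -/
def start (P : Cmd) (n k : ℕ) : Config :=
  ([P], { reg := fun r => if r = 0 then n else if r = 1 then k else 0, mem := fun _ => 0 })

/-- `w = c · (number of bits of n)` is the word length: words have `O(log n)` bits. -/
def wordLength (c n : ℕ) : ℕ := c * n.size

/-- The random configuration reached after `T` steps on input `I` with parameter `k`. -/
def runInput (P : Cmd) (c : ℕ) (I : Input α n p) (k T : ℕ) : PMF Config :=
  run (wordLength c n) I T (start P n k)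

/-- Whatever the random choices and the comparison faults, `P` halts within `T` steps. -/
def HaltsWithin (P : Cmd) (c : ℕ) (I : Input α n p) (k T : ℕ) : Prop :=
  ∀ cfg ∈ (runInput P c I k T).support, cfg.1 = []

/-- The law of the output, which is the position held by register `0`. -/
def outputLaw (P : Cmd) (c : ℕ) (I : Input α n p) (k T : ℕ) : PMF ℕ :=
  (runInput P c I k T).map fun cfg => cfg.2.reg 0

/-- In the worst case `P` halts within `T` steps on input `I`, and, except with probability at
most `δ`, it returns the position of one of the smallest `k` elements. -/
def Solves (P : Cmd) (c : ℕ) (I : Input α n p) (k T : ℕ) (δ : ℝ≥0∞) : Prop :=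
  HaltsWithin P c I k T ∧
    (outputLaw P c I k T).toOuterMeasure {v | ¬ ∃ i : Fin n, (i : ℕ) = v ∧ I.IsSmall k i} ≤ δ

end Semantics

end FTMin

end

/-! The analysis rests on an exact reduction to one scalar. Sampling is with replacement and matches
in a round are disjoint, so after every round the remaining contestants are again independent with a
common law (`iid_bind_play`). A tournament is therefore an iteration of `Input.duel` on laws on `Fin
n`, and only the mass `a` outside the smallest `k` elements matters. If a match errs with
probability at most `δ`, then `a` becomes at most `a ^ 2 + 2 * a * (1 - a) * δ` (`loss_duel_le`); an
exponential moment bound gives `δ = 4 ^ (-t)` for about `2 * c_p * t` comparisons.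

Two regimes suffice. From `a ≤ 1/4`, doubling `t` in every round makes `a` decrease doubly
exponentially, while the halving of the field keeps the cost per round constant: this is the
knockout tournament (`loss_champion_double`). From `a = 1 - k/n`, about `log (n/k)` rounds with `t`
growing by one bring `a` below `1/4`: the exponent of `1 - k/n` doubles per round, and the
accumulated errors form a convergent geometric series (`loss_champion_succ`). Their cost is linear
in the initial field, since halving beats linear growth.

For FT-Min(k), start with `2 ^ h * 2 ^ r` contestants, where `2 ^ h` is of order `log n` and `2 ^ r`
of order `n / k`. The slow phase costs `O((n/k) log n)` and leaves `2 ^ h` contestants; the doubling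
phase on these costs `O(h * 2 ^ h)` and fails with probability at most `1/n`.

The machine side is a compositional calculus, `Exec`: it couples the value computed, the final state
and the random number of steps. Loop invariants identify the law of the output with that of the
abstract tournament, under bounds that exclude overflow. -/

noncomputable section

namespace FTMin

/-! ### Expectations with respect to a discrete law -/

section Expectation

variable {A B : Type*}

/-- The expectation of a nonnegative function. -/
def expect (μ : PMF A) (f : A → ℝ≥0∞) : ℝ≥0∞ := ∑' a, μ a * f a

theorem expect_pure (a : A) (f : A → ℝ≥0∞) : expect (PMF.pure a) f = f a := by
  rw [expect, tsum_eq_single a]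
  · simp
  · intro b hb
    simp [PMF.pure_apply, hb]

theorem expect_bind (μ : PMF A) (κ : A → PMF B) (f : B → ℝ≥0∞) :
    expect (μ.bind κ) f = expect μ fun a => expect (κ a) f := by
  simp only [expect, PMF.bind_apply, ← ENNReal.tsum_mul_right, ← ENNReal.tsum_mul_left]
  rw [ENNReal.tsum_comm]
  simp only [mul_assoc]

theorem expect_map (μ : PMF A) (g : A → B) (f : B → ℝ≥0∞) :
    expect (μ.map g) f = expect μ fun a => f (g a) := by
  rw [← PMF.bind_pure_comp, expect_bind]
  simp only [Function.comp, expect_pure]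

theorem expect_mono (μ : PMF A) {f g : A → ℝ≥0∞} (h : ∀ a, f a ≤ g a) :
    expect μ f ≤ expect μ g :=
  ENNReal.tsum_le_tsum fun a => mul_le_mul_right (h a) _

theorem expect_mul_left (μ : PMF A) (c : ℝ≥0∞) (f : A → ℝ≥0∞) :
    (expect μ fun a => c * f a) = c * expect μ f := by
  simp only [expect, ← ENNReal.tsum_mul_left]
  exact tsum_congr fun a => by ring

theorem expect_mul_right (μ : PMF A) (c : ℝ≥0∞) (f : A → ℝ≥0∞) :
    (expect μ fun a => f a * c) = expect μ f * c := by
  simp only [mul_comm _ c, expect_mul_left]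

theorem expect_add (μ : PMF A) (f g : A → ℝ≥0∞) :
    (expect μ fun a => f a + g a) = expect μ f + expect μ g := by
  simp only [expect, mul_add, ENNReal.tsum_add]

theorem expect_const (μ : PMF A) (c : ℝ≥0∞) : (expect μ fun _ => c) = c := by
  simp [expect, ENNReal.tsum_mul_right]

theorem expect_bool (μ : PMF Bool) (f : Bool → ℝ≥0∞) :
    expect μ f = μ true * f true + μ false * f false := by
  rw [expect, tsum_fintype, Fintype.sum_bool]

theorem toOuterMeasure_eq_expect (μ : PMF A) (s : Set A) :
    μ.toOuterMeasure s = expect μ (s.indicator 1) := by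
  rw [PMF.toOuterMeasure_apply, expect]
  refine tsum_congr fun a => ?_
  by_cases h : a ∈ s <;> simp [h]

end Expectation

/-! ### Exponential moment bounds for majority votes -/

section Majority

variable {α : Type u} [LinearOrder α] {n : ℕ} {p : ℝ}

theorem coin_apply_true (e : unitInterval) : coin e true = ENNReal.ofReal e := rfl

theorem coin_apply_false (e : unitInterval) : coin e false = ENNReal.ofReal (1 - e) := rfl

/-- Independence of the comparisons makes the generating function of the vote count multiplicative.
-/
theorem expect_votes_pow (I : Input α n p) (i j : Fin n) (z : ℝ≥0∞) (N : ℕ) :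
    (expect (I.votes i j N) fun v => z ^ v) =
      (expect (I.report i j) fun b => z ^ b.toNat) ^ N := by
  induction N with
  | zero => simp [Input.votes, expect_pure]
  | succ N ih =>
    simp only [Input.votes, expect_bind, expect_map, pow_add, expect_mul_right, ih,
      expect_mul_left]
    ring

theorem expect_report_of_lt (I : Input α n p) {i j : Fin n} (h : I.key i < I.key j)
    (f : Bool → ℝ≥0∞) : expect (I.report i j) f =
      ENNReal.ofReal (I.err i j) * f false + ENNReal.ofReal (1 - I.err i j) * f true := by
  have hij : i ≠ j := fun e => by simp [e] at h
  rw [Input.report, if_neg hij, expect_map, expect_bool, coin_apply_true, coin_apply_false]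
  simp [h]

theorem expect_report_of_gt (I : Input α n p) {i j : Fin n} (h : I.key j < I.key i)
    (f : Bool → ℝ≥0∞) : expect (I.report i j) f =
      ENNReal.ofReal (I.err i j) * f true + ENNReal.ofReal (1 - I.err i j) * f false := by
  have hij : i ≠ j := fun e => by simp [e] at h
  rw [Input.report, if_neg hij, expect_map, expect_bool, coin_apply_true, coin_apply_false]
  simp [not_lt.2 h.le]

/-- The exponential moment of one comparison, at the parameter `1 + (1 - 2 * p)`. -/
theorem moment_le {e : ℝ} (he0 : 0 ≤ e) (he1 : e ≤ 1) (he : e ≤ p) (hp : p < 1 / 2) :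
    ENNReal.ofReal e * ENNReal.ofReal (2 - 2 * p) +
        ENNReal.ofReal (1 - e) * (ENNReal.ofReal (2 - 2 * p))⁻¹ ≤
      ENNReal.ofReal (1 - (1 - 2 * p) ^ 2 / 2) := by
  have h2 : 0 < 2 - 2 * p := by linarith
  rw [← ENNReal.ofReal_inv_of_pos h2, ← ENNReal.ofReal_mul he0,
    ← ENNReal.ofReal_mul (by linarith), ← ENNReal.ofReal_add (by positivity)
      (mul_nonneg (by linarith) (by positivity))]
  apply ENNReal.ofReal_le_ofReal
  rw [← div_eq_mul_inv, ← le_sub_iff_add_le', div_le_iff₀ h2]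
  -- With `b = 2 - 2 * p`, one has `b ^ 2 - 1 = (1 - 2 * p) * (3 - 2 * p)`, so this is what is lost,
  -- after multiplication by `b`, on raising `e` to `p`. At `e = p` the claim is an equality.
  have : 0 ≤ (p - e) * (1 - 2 * p) * (3 - 2 * p) :=
    mul_nonneg (mul_nonneg (by linarith) (by linarith)) (by linarith)
  nlinarith

/-- Since `1 - x ≤ exp (-x)`, a block of `2 * c_p` comparisons contributes at most `exp (-c_p * (1 -
2 * p) ^ 2)`. The choice of `c_p` makes the exponent at most `-4 * (1 - p) ≤ -2`, and `exp (-2) ≤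
1/4`. -/
theorem boostConst_pow_le (hp : p < 1 / 2) (hp0 : 0 ≤ p) (t N : ℕ)
    (hN : 2 * boostConst p * t ≤ N) :
    ENNReal.ofReal (1 - (1 - 2 * p) ^ 2 / 2) ^ N ≤ (4⁻¹ : ℝ≥0∞) ^ t := by
  have hε : 0 < 1 - 2 * p := by linarith
  have hε1 : (1 - 2 * p) ^ 2 ≤ 1 := by nlinarith
  have hx0 : 0 ≤ 1 - (1 - 2 * p) ^ 2 / 2 := by linarith
  have hx1 : 1 - (1 - 2 * p) ^ 2 / 2 ≤ 1 := by nlinarith [sq_nonneg (1 - 2 * p)]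
  have hc : 4 * (1 - p) / (1 - 2 * p) ^ 2 ≤ boostConst p := Nat.le_ceil _
  rw [div_le_iff₀ (by positivity)] at hc
  have key : (1 - (1 - 2 * p) ^ 2 / 2) ^ (2 * boostConst p) ≤ 4⁻¹ := by
    have h1 : 1 - (1 - 2 * p) ^ 2 / 2 ≤ Real.exp (-((1 - 2 * p) ^ 2 / 2)) := by
      have := Real.add_one_le_exp (-((1 - 2 * p) ^ 2 / 2))
      linarith
    calc _ ≤ Real.exp (-((1 - 2 * p) ^ 2 / 2)) ^ (2 * boostConst p) := by gcongr
      _ = Real.exp (-(boostConst p * (1 - 2 * p) ^ 2)) := by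
        rw [← Real.exp_nat_mul]; push_cast; ring_nf
      _ ≤ Real.exp (-2) := by
        apply Real.exp_le_exp.2
        linarith
      _ ≤ 4⁻¹ := by
        rw [Real.exp_neg]
        apply inv_anti₀ (by norm_num)
        have := Real.add_one_le_exp (1 : ℝ)
        have h3 : Real.exp 2 = Real.exp 1 * Real.exp 1 := by rw [← Real.exp_add]; norm_num
        nlinarith
  calc _ ≤ ENNReal.ofReal (1 - (1 - 2 * p) ^ 2 / 2) ^ (2 * boostConst p * t) := by
        apply pow_le_pow_of_le_one zero_le _ hN
        rw [← ENNReal.ofReal_one]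
        exact ENNReal.ofReal_le_ofReal hx1
    _ = ENNReal.ofReal ((1 - (1 - 2 * p) ^ 2 / 2) ^ (2 * boostConst p)) ^ t := by
        rw [pow_mul, ENNReal.ofReal_pow hx0]
    _ ≤ _ := by
        gcongr
        refine (ENNReal.ofReal_le_ofReal key).trans_eq ?_
        rw [ENNReal.ofReal_inv_of_pos (by norm_num)]
        norm_num

/-- A majority vote among at least `2 * c_p * t` comparisons of the `i`-th with the larger `j`-th
element returns the wrong element with probability at most `4 ^ (-t)`. -/
theorem majority_of_lt (I : Input α n p) (hp0 : 0 ≤ p) (hp : p < 1 / 2) {t N : ℕ}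
    (hN : 2 * boostConst p * t ≤ N) {i j : Fin n} (h : I.key i < I.key j) :
    expect (I.majority N i j) (({i} : Set (Fin n))ᶜ.indicator 1) ≤ (4⁻¹ : ℝ≥0∞) ^ t := by
  refine le_trans ?_ (boostConst_pow_le hp hp0 t N hN)
  set b := ENNReal.ofReal (2 - 2 * p) with hb
  have hb1 : 1 ≤ b := by
    rw [hb, ← ENNReal.ofReal_one]; exact ENNReal.ofReal_le_ofReal (by linarith)
  have hb0 : b ≠ 0 := (zero_lt_one.trans_le hb1).ne'
  have hbt : b ≠ ∞ := ENNReal.ofReal_ne_top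
  have hba : b * b⁻¹ = 1 := ENNReal.mul_inv_cancel hb0 hbt
  -- Exponential Markov inequality: the wrong element wins only if `2 * v ≤ N`, and then the weight
  -- `b ^ (N - 2 * v)` is at least `1`. A tie counts as an error, so the parity of `N` plays no
  -- role.
  calc _ ≤ expect (I.votes i j N) fun v => b ^ N * (b⁻¹ ^ 2) ^ v := by
        rw [Input.majority, expect_map]
        refine expect_mono _ fun v => ?_
        split_ifs with hv
        · simp
        · have hv : 2 * v ≤ N := not_lt.1 hv
          obtain ⟨m, rfl⟩ := Nat.exists_eq_add_of_le hv
          refine (Set.indicator_le_self' (fun _ _ => zero_le) _).trans ?_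
          rw [← pow_mul, pow_add, mul_right_comm, ← mul_pow, hba, one_pow, one_mul]
          exact one_le_pow₀ hb1
    _ = (ENNReal.ofReal (I.err i j) * b + ENNReal.ofReal (1 - I.err i j) * b⁻¹) ^ N := by
        rw [expect_mul_left, expect_votes_pow, expect_report_of_lt I h, ← mul_pow]
        congr 1
        simp only [Bool.toNat_false, Bool.toNat_true, pow_zero, pow_one, mul_one]
        calc _ = ENNReal.ofReal (I.err i j) * b +
              ENNReal.ofReal (1 - I.err i j) * b⁻¹ * (b * b⁻¹) := by ring
          _ = _ := by rw [hba, mul_one]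
    _ ≤ _ := by
        gcongr
        exact moment_le (I.err i j).2.1 (I.err i j).2.2 (I.err_le i j) hp

theorem majority_of_gt (I : Input α n p) (hp0 : 0 ≤ p) (hp : p < 1 / 2) {t N : ℕ}
    (hN : 2 * boostConst p * t ≤ N) {i j : Fin n} (h : I.key j < I.key i) :
    expect (I.majority N i j) (({j} : Set (Fin n))ᶜ.indicator 1) ≤ (4⁻¹ : ℝ≥0∞) ^ t := by
  refine le_trans ?_ (boostConst_pow_le hp hp0 t N hN)
  set b := ENNReal.ofReal (2 - 2 * p) with hb
  have hb1 : 1 ≤ b := by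
    rw [hb, ← ENNReal.ofReal_one]; exact ENNReal.ofReal_le_ofReal (by linarith)
  have hb0 : b ≠ 0 := (zero_lt_one.trans_le hb1).ne'
  have hbt : b ≠ ∞ := ENNReal.ofReal_ne_top
  have hba : b⁻¹ * b = 1 := ENNReal.inv_mul_cancel hb0 hbt
  calc _ ≤ expect (I.votes i j N) fun v => b⁻¹ ^ N * (b ^ 2) ^ v := by
        rw [Input.majority, expect_map]
        refine expect_mono _ fun v => ?_
        split_ifs with hv
        · obtain ⟨m, hm⟩ := Nat.exists_eq_add_of_le hv.le
          refine (Set.indicator_le_self' (fun _ _ => zero_le) _).trans ?_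
          rw [← pow_mul, hm, pow_add, ← mul_assoc, ← mul_pow, hba, one_pow, one_mul]
          exact one_le_pow₀ hb1
        · simp
    _ = (ENNReal.ofReal (I.err i j) * b + ENNReal.ofReal (1 - I.err i j) * b⁻¹) ^ N := by
        rw [expect_mul_left, expect_votes_pow, expect_report_of_gt I h, ← mul_pow]
        congr 1
        simp only [Bool.toNat_false, Bool.toNat_true, pow_zero, pow_one, mul_one]
        calc _ = ENNReal.ofReal (I.err i j) * b * (b⁻¹ * b) +
              ENNReal.ofReal (1 - I.err i j) * b⁻¹ := by ring
          _ = _ := by rw [hba, mul_one]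
    _ ≤ _ := by
        gcongr
        exact moment_le (I.err i j).2.1 (I.err i j).2.2 (I.err_le i j) hp

theorem Input.IsSmall.key_lt {I : Input α n p} {k : ℕ} {i j : Fin n} (hi : I.IsSmall k i)
    (hj : ¬ I.IsSmall k j) : I.key i < I.key j := by
  by_contra hlt
  refine hj (lt_of_le_of_lt (Finset.card_le_card fun x hx => ?_) hi)
  simp only [Finset.mem_filter, Finset.mem_univ, true_and] at hx ⊢
  exact hx.trans_le (not_lt.1 hlt)

/-! ### Tournaments among independent contestants -/

/-- The law of the winner of a match between two independent contestants. -/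
def Input.duel (I : Input α n p) (N : ℕ) (D : PMF (Fin n)) : PMF (Fin n) :=
  D.bind fun x => D.bind fun y => I.majority N x y

/-- The indicator of the elements that are not among the smallest `k`. -/
def Input.large (I : Input α n p) (k : ℕ) (i : Fin n) : ℝ≥0∞ :=
  {i | ¬ I.IsSmall k i}.indicator 1 i

theorem Input.large_of_isSmall {I : Input α n p} {k : ℕ} {i : Fin n} (h : I.IsSmall k i) :
    I.large k i = 0 := by simp [Input.large, h]

theorem Input.large_of_not {I : Input α n p} {k : ℕ} {i : Fin n} (h : ¬ I.IsSmall k i) :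
    I.large k i = 1 := by simp [Input.large, h]

theorem Input.large_le_one (I : Input α n p) (k : ℕ) (i : Fin n) : I.large k i ≤ 1 := by
  by_cases h : I.IsSmall k i <;> simp [Input.large, h]

/-- A match always returns one of its two contestants, so faults matter only when exactly one of
them is small. In that case the small one has the smaller key, and a large winner requires a wrong
majority. -/
theorem expect_majority_large (I : Input α n p) (hp0 : 0 ≤ p) (hp : p < 1 / 2) {t N : ℕ}
    (hN : 2 * boostConst p * t ≤ N) (k : ℕ) (x y : Fin n) :
    expect (I.majority N x y) (I.large k) ≤
      I.large k x * I.large k y + (I.large k x * (1 - I.large k y) +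
        (1 - I.large k x) * I.large k y) * 4⁻¹ ^ t := by
  have compl : ∀ {z : Fin n}, I.IsSmall k z → ∀ w,
      I.large k w ≤ ({z} : Set (Fin n))ᶜ.indicator 1 w := by
    intro z hz w
    by_cases hw : w = z
    · subst hw; simp [Input.large_of_isSmall hz]
    · simpa [hw] using I.large_le_one k w
  by_cases hx : I.IsSmall k x <;> by_cases hy : I.IsSmall k y
  · simp only [Input.large_of_isSmall hx, Input.large_of_isSmall hy]
    rw [Input.majority, expect_map]
    refine (expect_mono (g := fun _ => 0) _ fun v => ?_).trans (by simp [expect_const])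
    split_ifs
    · simp [Input.large_of_isSmall hx]
    · simp [Input.large_of_isSmall hy]
  · simp only [Input.large_of_isSmall hx, Input.large_of_not hy]
    simpa using (expect_mono _ (compl hx)).trans (majority_of_lt I hp0 hp hN (hx.key_lt hy))
  · simp only [Input.large_of_not hx, Input.large_of_isSmall hy]
    simpa using (expect_mono _ (compl hy)).trans (majority_of_gt I hp0 hp hN (hy.key_lt hx))
  · simp only [Input.large_of_not hx, Input.large_of_not hy]
    refine (expect_mono _ (I.large_le_one k)).trans ?_
    simp [expect_const]

/-- The probability that a random element is not among the smallest `k`. -/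
def Input.loss (I : Input α n p) (k : ℕ) (D : PMF (Fin n)) : ℝ :=
  (expect D (I.large k)).toReal

theorem expect_large_le_one (I : Input α n p) (k : ℕ) (D : PMF (Fin n)) :
    expect D (I.large k) ≤ 1 :=
  (expect_mono _ (I.large_le_one k)).trans_eq (expect_const _ _)

theorem ofReal_loss (I : Input α n p) (k : ℕ) (D : PMF (Fin n)) :
    ENNReal.ofReal (I.loss k D) = expect D (I.large k) :=
  ENNReal.ofReal_toReal ((expect_large_le_one I k D).trans_lt ENNReal.one_lt_top).ne

theorem loss_nonneg (I : Input α n p) (k : ℕ) (D : PMF (Fin n)) : 0 ≤ I.loss k D :=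
  ENNReal.toReal_nonneg

theorem loss_le_one (I : Input α n p) (k : ℕ) (D : PMF (Fin n)) : I.loss k D ≤ 1 :=
  ENNReal.toReal_le_of_le_ofReal zero_le_one (by simpa using expect_large_le_one I k D)

/-- The pointwise bound for a match is a sum of products of functions of `x` and of `y`; by
independence its expectation factors. -/
theorem loss_duel_le (I : Input α n p) (hp0 : 0 ≤ p) (hp : p < 1 / 2) {t N : ℕ}
    (hN : 2 * boostConst p * t ≤ N) (k : ℕ) (D : PMF (Fin n)) :
    I.loss k (I.duel N D) ≤
      I.loss k D ^ 2 + 2 * I.loss k D * (1 - I.loss k D) * (4⁻¹ : ℝ) ^ t := by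
  have hq : expect D (fun x => 1 - I.large k x) = ENNReal.ofReal (1 - I.loss k D) := by
    have h1 : expect D (fun x => 1 - I.large k x) + expect D (I.large k) = 1 := by
      rw [← expect_add]
      simp only [tsub_add_cancel_of_le (I.large_le_one k _), expect_const]
    rw [ENNReal.ofReal_sub _ (loss_nonneg _ _ _), ofReal_loss, ENNReal.ofReal_one]
    exact ENNReal.eq_sub_of_add_eq
      ((expect_large_le_one I k D).trans_lt ENNReal.one_lt_top).ne h1
  refine ENNReal.toReal_le_of_le_ofReal (by
    have := loss_nonneg I k D
    have := loss_le_one I k D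
    have : 0 ≤ 1 - I.loss k D := by linarith
    positivity) ?_
  have h0 := loss_nonneg I k D
  have h1 : 0 ≤ 1 - I.loss k D := by linarith [loss_le_one I k D]
  calc expect (I.duel N D) (I.large k)
      ≤ expect D fun x => expect D fun y => I.large k x * I.large k y +
        (I.large k x * (1 - I.large k y) + (1 - I.large k x) * I.large k y) * 4⁻¹ ^ t := by
        simp only [Input.duel, expect_bind]
        exact expect_mono _ fun x => expect_mono _ fun y =>
          expect_majority_large I hp0 hp hN k x y
    _ = expect D (I.large k) * expect D (I.large k) +
        (expect D (I.large k) * expect D (fun x => 1 - I.large k x) +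
          expect D (fun x => 1 - I.large k x) * expect D (I.large k)) * 4⁻¹ ^ t := by
        simp only [expect_add, expect_mul_left, expect_mul_right]
    _ = _ := by
        rw [hq, ← ofReal_loss, ENNReal.ofReal_add (by positivity) (by positivity),
          ENNReal.ofReal_mul (by positivity), ENNReal.ofReal_mul (by positivity),
          ENNReal.ofReal_mul (by positivity), ENNReal.ofReal_pow h0,
          ENNReal.ofReal_pow (by positivity), ENNReal.ofReal_inv_of_pos (by norm_num)]
        norm_num
        ring

/-! ### Rounds among independent contestants as a recursion on one law -/

/-- `N` independent samples from `D`. -/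
def iid (D : PMF (Fin n)) : ℕ → PMF (List (Fin n))
  | 0 => PMF.pure []
  | N + 1 => D.bind fun x => (iid D N).map fun l => x :: l

theorem samples_eq_iid [NeZero n] (N : ℕ) :
    samples n N = iid (PMF.uniformOfFintype (Fin n)) N := by
  induction N with
  | zero => rfl
  | succ N ih => rw [samples, iid, ih]

/-- One round with matches of `N` comparisons. -/
def Input.play (I : Input α n p) (N : ℕ) : List (Fin n) → PMF (List (Fin n))
  | x :: y :: l => (I.majority N x y).bind fun w => (I.play N l).map fun r => w :: r
  | l => PMF.pure l

/-- `r` rounds; the parameter `t` of the match length is updated by `f` before each round. -/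
def Input.playFrom (I : Input α n p) (f : ℕ → ℕ) : ℕ → ℕ → List (Fin n) → PMF (List (Fin n))
  | _, 0, l => PMF.pure l
  | t, r + 1, l =>
    (I.play (2 * boostConst p * f t + 5) l).bind (I.playFrom f (f t) r)

/-- The law of the winner of `r` rounds among independent contestants with law `D`. -/
def Input.champion (I : Input α n p) (f : ℕ → ℕ) : ℕ → ℕ → PMF (Fin n) → PMF (Fin n)
  | _, 0, D => D
  | t, r + 1, D => I.champion f (f t) r (I.duel (2 * boostConst p * f t + 5) D)

theorem playRound_eq_play (I : Input α n p) (i : ℕ) : ∀ l : List (Fin n),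
    I.playRound i l = I.play (matchLength p i) l
  | [] => rfl
  | [_] => rfl
  | x :: y :: l => by
    rw [Input.playRound, Input.play, playRound_eq_play I i l]

/-- The parameter is doubled before it is used, so round `i + 1`, with parameter `2 ^ (i + 1)`,
starts from `2 ^ i`. -/
theorem playRounds_eq_playFrom (I : Input α n p) (i r : ℕ) (l : List (Fin n)) :
    I.playRounds (i + 1) r l = I.playFrom (fun t => t * 2) (2 ^ i) r l := by
  induction r generalizing i l with
  | zero => rfl
  | succ r ih =>
    rw [Input.playRounds, Input.playFrom, playRound_eq_play, matchLength, pow_succ]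
    congr 1
    funext l'
    rw [ih, pow_succ]

/-- Disjoint pairs of independent contestants yield independent winners. In the induction, the first
match is commuted past the sampling of the remaining contestants. -/
theorem iid_bind_play (I : Input α n p) (N : ℕ) (D : PMF (Fin n)) (m : ℕ) :
    (iid D (2 * m)).bind (I.play N) = iid (I.duel N D) m := by
  induction m with
  | zero => simp [iid, Input.play]
  | succ m ih =>
    rw [show 2 * (m + 1) = 2 * m + 1 + 1 by ring, iid, iid, iid, ← ih, Input.duel]
    simp only [PMF.bind_bind, PMF.bind_map, PMF.map_bind, Function.comp_def, Input.play]
    congr 1; funext x; congr 1; funext y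
    rw [PMF.bind_comm]

theorem iid_bind_playFrom (I : Input α n p) (f : ℕ → ℕ) (t r m : ℕ) (D : PMF (Fin n)) :
    (iid D (m * 2 ^ r)).bind (I.playFrom f t r) = iid (I.champion f t r D) m := by
  induction r generalizing t D with
  | zero => simp [Input.playFrom, Input.champion]
  | succ r ih =>
    simp only [Input.playFrom, Input.champion]
    rw [← PMF.bind_bind, show m * 2 ^ (r + 1) = 2 * (m * 2 ^ r) by ring, iid_bind_play, ih]

theorem iid_one_map_headD [NeZero n] (D : PMF (Fin n)) :
    ((iid D 1).map fun l => l.headD 0) = D := by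
  simp [iid, PMF.map_bind, PMF.pure_map]

theorem knockout_eq_champion [NeZero n] (I : Input α n p) (h : ℕ) :
    I.knockout h = I.champion (fun t => t * 2) 1 h (PMF.uniformOfFintype (Fin n)) := by
  have : I.playRounds 1 h = I.playFrom (fun t => t * 2) 1 h :=
    funext fun l => playRounds_eq_playFrom I 0 h l
  rw [Input.knockout, this, samples_eq_iid, ← one_mul (2 ^ h), iid_bind_playFrom,
    iid_one_map_headD]

/-! ### Decay of the failure probability over the rounds -/

/-- Once the contestants are among the smallest `k` with probability at least `3 / 4`, doubling
the match length from round to round makes the failure probability decrease doubly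
exponentially. -/
theorem loss_champion_double (I : Input α n p) (hp0 : 0 ≤ p) (hp : p < 1 / 2) (k i r : ℕ)
    (D : PMF (Fin n)) (hD : I.loss k D ≤ (2⁻¹ : ℝ) ^ (2 ^ i + 1)) :
    I.loss k (I.champion (fun t => t * 2) (2 ^ i) r D) ≤ (2⁻¹ : ℝ) ^ (2 ^ (i + r) + 1) := by
  induction r generalizing i D with
  | zero => simpa [Input.champion] using hD
  | succ r ih =>
    rw [Input.champion, ← pow_succ, show i + (r + 1) = i + 1 + r by ring]
    refine ih (i + 1) _ ((loss_duel_le I hp0 hp (t := 2 ^ (i + 1)) (by omega) k D).trans ?_)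
    have h0 := loss_nonneg I k D
    have h1 : 1 - I.loss k D ≤ 1 := by linarith
    set a := I.loss k D
    have hx : (0 : ℝ) < 2⁻¹ ^ (2 ^ i) := by positivity
    have hx1 : (2⁻¹ : ℝ) ^ (2 ^ i) ≤ 2⁻¹ := by
      conv_rhs => rw [← pow_one (2⁻¹ : ℝ)]
      exact pow_le_pow_of_le_one (by norm_num) (by norm_num) Nat.one_le_two_pow
    -- In terms of `x = 2 ^ (-2 ^ i)`: the loss is at most `x / 2`, the match error is `x ^ 4`, and
    -- the target is `x ^ 2 / 2`. The bound becomes `x ^ 2 / 4 + x ^ 5`, and `x ^ 3 ≤ 1/8`.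
    have e4 : (4⁻¹ : ℝ) ^ 2 ^ (i + 1) = (2⁻¹ ^ (2 ^ i)) ^ 4 := by
      rw [show (4⁻¹ : ℝ) = 2⁻¹ ^ 2 by norm_num, ← pow_mul, ← pow_mul]
      congr 1; ring
    have e2 : (2⁻¹ : ℝ) ^ (2 ^ (i + 1) + 1) = (2⁻¹ ^ (2 ^ i)) ^ 2 / 2 := by
      rw [pow_succ, pow_succ 2 i, pow_mul]; ring
    rw [e4, e2]
    rw [pow_succ] at hD
    set x := (2⁻¹ : ℝ) ^ 2 ^ i
    have : 2 * a * (1 - a) * x ^ 4 ≤ 2 * (x * 2⁻¹) * 1 * x ^ 4 := by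
      have : 0 ≤ 1 - a ∨ 1 - a ≤ 0 := le_total _ _
      rcases this with h | h
      · gcongr
      · have : 0 ≤ 2 * a * x ^ 4 := by positivity
        have : 0 ≤ 2 * (x * 2⁻¹) * 1 * x ^ 4 := by positivity
        nlinarith
    have h5 : x ^ 3 ≤ 2⁻¹ ^ 3 := by gcongr
    have : a ^ 2 ≤ (x * 2⁻¹) ^ 2 := by gcongr
    nlinarith [mul_le_mul_of_nonneg_left h5 (sq_nonneg x)]

/-- In rounds with match parameters `t + 1, …, t + r` a failure probability `x` is squared in each
round, up to the success probabilities of the matches, whose product is at least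
`1 - 4 ^ (-t) / 3`. -/
theorem loss_champion_succ (I : Input α n p) (hp0 : 0 ≤ p) (hp : p < 1 / 2) (k t r : ℕ)
    (D : PMF (Fin n)) (a x : ℝ) (ha0 : 0 ≤ a) (ha1 : a ≤ 1) (hx0 : 0 ≤ x) (hx1 : x ≤ 1)
    (hD : I.loss k D ≤ 1 - a * (1 - x)) :
    I.loss k (I.champion (fun t => t + 1) t r D) ≤
      1 - a * (1 - (4⁻¹ ^ t) / 3) * (1 - x ^ 2 ^ r) := by
  have weak : ∀ (t : ℕ) (a z : ℝ), 0 ≤ a → z ≤ 1 →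
      1 - a * (1 - z) ≤ 1 - a * (1 - (4⁻¹ ^ t) / 3) * (1 - z) := by
    intro t a z ha hz
    have : 0 ≤ a * (1 - z) * ((4⁻¹ ^ t) / 3) :=
      mul_nonneg (mul_nonneg ha (by linarith)) (by positivity)
    nlinarith
  induction r generalizing t D a x with
  | zero =>
    refine hD.trans ?_
    simpa [Input.champion] using weak t a x ha0 hx1
  | succ r ih =>
    have hδ0 : (0 : ℝ) ≤ 4⁻¹ ^ (t + 1) := by positivity
    have hδ1 : (4⁻¹ : ℝ) ^ (t + 1) ≤ 1 := pow_le_one₀ (by norm_num) (by norm_num)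
    have hxr : x ^ 2 ^ (r + 1) ≤ 1 := pow_le_one₀ hx0 hx1
    rw [Input.champion]
    -- The factor `a` collects the success probabilities of the matches, while `x` is squared as if
    -- matches were faultless.
    refine (ih (t + 1) _ (a * (1 - 4⁻¹ ^ (t + 1))) (x ^ 2)
      (mul_nonneg ha0 (by linarith)) (by nlinarith) (by positivity)
      (pow_le_one₀ hx0 hx1) ?_).trans ?_
    · refine (loss_duel_le I hp0 hp (t := t + 1) (by omega) k D).trans ?_
      have h0 := loss_nonneg I k D
      set e := I.loss k D
      set δ := (4⁻¹ : ℝ) ^ (t + 1)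
      have hq : a * (1 - x) ≤ 1 - e := by linarith
      have hq1 : 1 - e ≤ 1 := by linarith
      set q := 1 - e with hqe
      have he : e = 1 - q := by linarith
      have hq0 : 0 ≤ q := le_trans (mul_nonneg ha0 (by linarith)) hq
      rw [he]
      have hu0 : 0 ≤ 1 - x := by linarith
      -- The new success probability is at least `(1 - δ) * (2 * q - q ^ 2) + δ * q ^ 2`. As `2 * q
      -- - q ^ 2` increases on `[0, 1]`, `q` may be replaced by `a * (1 - x)`; the result exceeds `a
      -- * (1 - x ^ 2)` by `a * (1 - a) * (1 - x) ^ 2`.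
      have h3 : (1 - δ) * (a * (1 - x ^ 2)) ≤ (1 - δ) * (2 * q - q ^ 2) := by
        apply mul_le_mul_of_nonneg_left _ (by linarith)
        have h4 : 2 * (a * (1 - x)) - (a * (1 - x)) ^ 2 ≤ 2 * q - q ^ 2 := by nlinarith
        have h5 : 0 ≤ a * (1 - a) * (1 - x) ^ 2 :=
          mul_nonneg (mul_nonneg ha0 (by linarith)) (sq_nonneg _)
        nlinarith
      nlinarith [mul_nonneg hδ0 (sq_nonneg q)]
    · have e1 : (x ^ 2) ^ 2 ^ r = x ^ 2 ^ (r + 1) := by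
        rw [← pow_mul]; congr 1; ring
      rw [e1]
      -- The `1/3` is the sum of `4 ^ (-s)` over `s ≥ 1`: with `δ = 4 ^ (-(t + 1))`, the first-order
      -- terms `δ + δ / 3` on the right match `4 * δ / 3` on the left.
      have h6 : 1 - (4⁻¹ : ℝ) ^ t / 3 ≤ (1 - 4⁻¹ ^ (t + 1)) * (1 - 4⁻¹ ^ (t + 1) / 3) := by
        have : (4⁻¹ : ℝ) ^ t = 4 * 4⁻¹ ^ (t + 1) := by rw [pow_succ]; ring
        rw [this]
        nlinarith
      have := mul_le_mul_of_nonneg_left h6 (mul_nonneg ha0 (sub_nonneg.2 hxr))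
      nlinarith

/-! ### Uniform samples and the resulting failure bounds -/

/-- The number of smaller elements. -/
def Input.rank (I : Input α n p) (i : Fin n) : Fin n :=
  ⟨(Finset.univ.filter fun j => I.key j < I.key i).card, by
    refine (Finset.card_lt_univ_of_notMem (x := i) (by simp)).trans_eq (Fintype.card_fin n)⟩

theorem rank_bijective (I : Input α n p) : Function.Bijective I.rank := by
  refine Finite.injective_iff_bijective.1 fun i j hij => ?_
  have hmono : ∀ {i j}, I.key i < I.key j → (I.rank i : ℕ) < I.rank j := by
    intro i j h
    simp only [Input.rank]
    refine Finset.card_lt_card ⟨fun x hx => ?_, fun hsub => ?_⟩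
    · simp only [Finset.mem_filter, Finset.mem_univ, true_and] at hx ⊢
      exact hx.trans h
    · have := hsub (by simpa using h : i ∈ _)
      simp at this
  by_contra hne
  rcases lt_or_gt_of_ne fun h => hne (I.key_injective h) with h | h
  · exact (hmono h).ne (congrArg Fin.val hij)
  · exact (hmono h).ne' (congrArg Fin.val hij)

/-- Distinct keys make the rank a permutation of `Fin n`; summing over ranks instead of positions,
exactly `n - k` terms are `1`. -/
theorem loss_uniform [NeZero n] (I : Input α n p) {k : ℕ} (hk : k ≤ n) :
    I.loss k (PMF.uniformOfFintype (Fin n)) = 1 - k / n := by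
  have hsum : ∑ i : Fin n, I.large k i = ((n - k : ℕ) : ℝ≥0∞) := by
    calc ∑ i : Fin n, I.large k i = ∑ i : Fin n, if (I.rank i : ℕ) < k then 0 else 1 := by
          refine Finset.sum_congr rfl fun i _ => ?_
          by_cases h : I.IsSmall k i
          · rw [Input.large_of_isSmall h, if_pos (show (I.rank i : ℕ) < k from h)]
          · rw [Input.large_of_not h, if_neg (show ¬ (I.rank i : ℕ) < k from h)]
      _ = ∑ i : Fin n, if (i : ℕ) < k then 0 else 1 :=
          (rank_bijective I).sum_comp fun i : Fin n => if (i : ℕ) < k then (0 : ℝ≥0∞) else 1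
      _ = _ := by
          rw [Fin.sum_univ_eq_sum_range (fun i => if i < k then (0 : ℝ≥0∞) else 1) n]
          obtain ⟨m, rfl⟩ := Nat.exists_eq_add_of_le hk
          rw [Finset.sum_range_add, Finset.sum_eq_zero fun i hi => if_pos (Finset.mem_range.1 hi)]
          simp
  have hn : (n : ℝ) ≠ 0 := NeZero.ne _
  rw [Input.loss, expect, tsum_fintype]
  simp only [PMF.uniformOfFintype_apply, ← Finset.mul_sum, hsum, Fintype.card_fin]
  rw [ENNReal.toReal_mul, ENNReal.toReal_inv, ENNReal.toReal_natCast, ENNReal.toReal_natCast,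
    Nat.cast_sub hk]
  field_simp

theorem loss_anti (I : Input α n p) {k k' : ℕ} (h : k ≤ k') (D : PMF (Fin n)) :
    I.loss k' D ≤ I.loss k D := by
  refine ENNReal.toReal_mono ((expect_large_le_one I k D).trans_lt ENNReal.one_lt_top).ne
    (expect_mono _ fun i => ?_)
  by_cases hi : I.IsSmall k i
  · rw [Input.large_of_isSmall (lt_of_lt_of_le hi h : I.IsSmall k' i)]
    exact zero_le
  · rw [Input.large_of_not hi]
    exact I.large_le_one _ _

theorem toOuterMeasure_not_isSmall (I : Input α n p) (k : ℕ) (D : PMF (Fin n)) :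
    D.toOuterMeasure {i | ¬ I.IsSmall k i} = ENNReal.ofReal (I.loss k D) := by
  rw [toOuterMeasure_eq_expect, ofReal_loss]
  rfl

theorem ofReal_inv_two_pow (m : ℕ) : ENNReal.ofReal (2⁻¹ ^ m) = (2⁻¹ : ℝ≥0∞) ^ m := by
  rw [ENNReal.ofReal_pow (by norm_num), ENNReal.ofReal_inv_of_pos (by norm_num)]
  norm_num

/-- The knockout tournament fails with probability at most `2 ^ (-(n + 1))`. -/
theorem knockout_failure (hp0 : 0 ≤ p) (hp : p < 1 / 2) (h k : ℕ) (I : Input α (2 ^ h) p)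
    (hk : 3 * 2 ^ h ≤ 4 * k) :
    (I.knockout h).toOuterMeasure {i | ¬ I.IsSmall k i} ≤ (2⁻¹ : ℝ≥0∞) ^ (2 ^ h + 1) := by
  rw [toOuterMeasure_not_isSmall, ← ofReal_inv_two_pow, knockout_eq_champion]
  apply ENNReal.ofReal_le_ofReal
  -- A uniform sample already has loss at most `1/4 = 2 ^ (-(2 ^ 0 + 1))`, the threshold for `i =
  -- 0`. Here `k` may exceed `2 ^ h`, hence the minimum.
  have := loss_champion_double I hp0 hp k 0 h (PMF.uniformOfFintype (Fin (2 ^ h))) (by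
    refine (loss_anti I (min_le_left k (2 ^ h)) _).trans ?_
    rw [loss_uniform I (min_le_right k (2 ^ h))]
    have h3 : 3 * 2 ^ h ≤ 4 * min k (2 ^ h) := by
      rw [← Nat.mul_min_mul_left]; exact le_min hk (by omega)
    have h4 : (3 : ℝ) * 2 ^ h ≤ 4 * (min k (2 ^ h) : ℕ) := by exact_mod_cast h3
    have h5 : (3 / 4 : ℝ) ≤ (min k (2 ^ h) : ℕ) / (2 ^ h : ℕ) := by
      rw [le_div_iff₀ (by positivity)]
      push_cast at h4 ⊢
      linarith
    norm_num at h5 ⊢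
    linarith)
  simpa using this

/-- `r` rounds with match parameters `2, …, r + 1` produce a contestant among the smallest `k` with
probability at least `3 / 4`, provided `4 * n ≤ k * 2 ^ r`. -/
theorem loss_champion_succ_uniform [NeZero n] (I : Input α n p) (hp0 : 0 ≤ p) (hp : p < 1 / 2)
    {k r : ℕ} (hkn : k ≤ n) (hr : 4 * n ≤ k * 2 ^ r) :
    I.loss k (I.champion (fun t => t + 1) 1 r (PMF.uniformOfFintype (Fin n))) ≤ 4⁻¹ := by
  have hn : (0 : ℝ) < n := Nat.cast_pos.2 (NeZero.pos n)
  have hf1 : (k / n : ℝ) ≤ 1 := by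
    rw [div_le_one hn]; exact_mod_cast hkn
  have hf0 : (0 : ℝ) ≤ k / n := by positivity
  refine (loss_champion_succ I hp0 hp k 1 r _ 1 (1 - k / n) zero_le_one le_rfl (by linarith)
    (by linarith) (by rw [loss_uniform I hkn]; linarith)).trans ?_
  -- This leaves success probability at least `(11/12) * (15/16) > 3/4`; the factor `11/12` accounts
  -- for all match errors from `t = 1` on.
  have hx : (1 - k / n : ℝ) ^ 2 ^ r ≤ 16⁻¹ := by
    calc (1 - k / n : ℝ) ^ 2 ^ r ≤ Real.exp (-(k / n)) ^ 2 ^ r := by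
          have h0 : 0 ≤ 1 - (k / n : ℝ) := by linarith
          exact pow_le_pow_left₀ h0 (Real.one_sub_le_exp_neg _) _
      _ = Real.exp (-((k : ℝ) * 2 ^ r / n)) := by
          rw [← Real.exp_nat_mul]
          congr 1
          push_cast
          ring
      _ ≤ Real.exp (-4) := by
          apply Real.exp_le_exp.2
          rw [neg_le_neg_iff, le_div_iff₀ hn]
          exact_mod_cast hr
      _ ≤ 16⁻¹ := by
          rw [Real.exp_neg]
          apply inv_anti₀ (by norm_num)
          have h1 := Real.add_one_le_exp (1 : ℝ)
          have h3 : Real.exp 4 = Real.exp 1 ^ 4 := by rw [← Real.exp_nat_mul]; norm_num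
          rw [h3]
          calc (16 : ℝ) = 2 ^ 4 := by norm_num
            _ ≤ _ := by gcongr; linarith
  norm_num at hx ⊢
  linarith

/-- A tournament with rounds of slowly growing length, followed by rounds of doubling length. -/
theorem loss_champion_two_phase [NeZero n] (I : Input α n p) (hp0 : 0 ≤ p) (hp : p < 1 / 2)
    {k r h : ℕ} (hkn : k ≤ n) (hr : 4 * n ≤ k * 2 ^ r) (hh : n ≤ 2 ^ 2 ^ h) :
    (I.champion (fun t => t * 2) 1 h (I.champion (fun t => t + 1) 1 r
      (PMF.uniformOfFintype (Fin n)))).toOuterMeasure {i | ¬ I.IsSmall k i} ≤ (n : ℝ≥0∞)⁻¹ := by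
  rw [toOuterMeasure_not_isSmall]
  have := loss_champion_double I hp0 hp k 0 h _
    ((loss_champion_succ_uniform I hp0 hp hkn hr).trans (by norm_num))
  rw [pow_zero, zero_add] at this
  refine (ENNReal.ofReal_le_ofReal this).trans ?_
  rw [ofReal_inv_two_pow, ← ENNReal.inv_pow]
  apply ENNReal.inv_le_inv.2
  have h2 : n ≤ 2 ^ (2 ^ h + 1) := hh.trans (Nat.pow_le_pow_right (by norm_num) (by omega))
  exact_mod_cast h2

end Majority

/-! ### A calculus for the execution of programs -/

section Exec

variable {α : Type u} [LinearOrder α] {n : ℕ} {p : ℝ} {A B : Type}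

theorem bind_congr_support {A B : Type*} (μ : PMF A) {f g : A → PMF B}
    (h : ∀ a ∈ μ.support, f a = g a) : μ.bind f = μ.bind g := by
  ext b
  simp only [PMF.bind_apply]
  refine tsum_congr fun a => ?_
  by_cases ha : a ∈ μ.support
  · rw [h a ha]
  · rw [(PMF.apply_eq_zero_iff _ _).2 ha, zero_mul, zero_mul]

/-- Executing the commands `cs` from the state `s` takes at most `t` steps and produces a random
value with law `μ`, which the final state represents in the sense of `R`. The witness is the joint
law of the value, the final state and the number of steps. -/
def Exec (w : ℕ) (I : Input α n p) (cs : List Cmd) (s : State) (t : ℕ) (μ : PMF A)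
    (R : A → State → Prop) : Prop :=
  ∃ κ : PMF (A × State × ℕ), κ.map Prod.fst = μ ∧
    (∀ x ∈ κ.support, R x.1 x.2.1 ∧ x.2.2 ≤ t) ∧
    ∀ K T, t ≤ T →
      run w I T (cs ++ K, s) = κ.bind fun x => run w I (T - x.2.2) (K, x.2.1)

variable {w : ℕ} {I : Input α n p} {cs : List Cmd} {s : State} {t : ℕ}
  {μ : PMF A} {R : A → State → Prop}

theorem Exec.nil {a : A} (h : R a s) : Exec w I [] s 0 (PMF.pure a) R := by
  refine ⟨PMF.pure (a, s, 0), by simp [PMF.pure_map], ?_, fun K T _ => by simp⟩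
  intro x hx
  rw [PMF.mem_support_pure_iff] at hx
  subst hx
  exact ⟨h, le_rfl⟩

theorem Exec.mono {t' : ℕ} {R' : A → State → Prop} (h : Exec w I cs s t μ R) (ht : t ≤ t')
    (hR : ∀ a s', R a s' → R' a s') : Exec w I cs s t' μ R' := by
  obtain ⟨κ, h1, h2, h3⟩ := h
  exact ⟨κ, h1, fun x hx => ⟨hR _ _ (h2 x hx).1, (h2 x hx).2.trans ht⟩,
    fun K T hT => h3 K T (ht.trans hT)⟩

theorem Exec.congr_law {ν : PMF A} (h : Exec w I cs s t μ R) (e : μ = ν) :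
    Exec w I cs s t ν R := e ▸ h

theorem Exec.map {R' : B → State → Prop} (h : Exec w I cs s t μ R) (f : A → B)
    (hR : ∀ a s', R a s' → R' (f a) s') : Exec w I cs s t (μ.map f) R' := by
  obtain ⟨κ, h1, h2, h3⟩ := h
  refine ⟨κ.map fun x => (f x.1, x.2), ?_, ?_, fun K T hT => ?_⟩
  · rw [← h1, PMF.map_comp, PMF.map_comp]; rfl
  · intro x hx
    obtain ⟨y, hy, rfl⟩ := (PMF.mem_support_map_iff _ _ _).1 hx
    exact ⟨hR _ _ (h2 y hy).1, (h2 y hy).2⟩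
  · rw [h3 K T hT, PMF.bind_map]; rfl

theorem Exec.append {cs' : List Cmd} {t' : ℕ} {ν : A → PMF B} {R' : B → State → Prop}
    (h : Exec w I cs s t μ R) (h' : ∀ a s', R a s' → Exec w I cs' s' t' (ν a) R') :
    Exec w I (cs ++ cs') s (t + t') (μ.bind ν) R' := by
  obtain ⟨κ, h1, h2, h3⟩ := h
  -- The second computation is controlled only on the support of the first; elsewhere an arbitrary
  -- law lets the choice be total.
  have : ∀ x : A × State × ℕ, ∃ η : PMF (B × State × ℕ), x ∈ κ.support →
      η.map Prod.fst = ν x.1 ∧ (∀ y ∈ η.support, R' y.1 y.2.1 ∧ y.2.2 ≤ t') ∧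
      ∀ K T, t' ≤ T →
        run w I T (cs' ++ K, x.2.1) = η.bind fun y => run w I (T - y.2.2) (K, y.2.1) := by
    intro x
    by_cases hx : x ∈ κ.support
    · obtain ⟨η, hη⟩ := h' _ _ (h2 x hx).1
      exact ⟨η, fun _ => hη⟩
    · exact ⟨(ν x.1).map fun b => (b, s, 0), fun h => absurd h hx⟩
  choose η hη using this
  refine ⟨κ.bind fun x => (η x).map fun y => (y.1, y.2.1, x.2.2 + y.2.2), ?_, ?_, ?_⟩
  · rw [← h1, PMF.bind_map, PMF.map_bind]
    refine bind_congr_support _ fun x hx => ?_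
    rw [PMF.map_comp, Function.comp_apply, ← (hη x hx).1]
    rfl
  · intro z hz
    obtain ⟨x, hx, hz⟩ := (PMF.mem_support_bind_iff _ _ _).1 hz
    obtain ⟨y, hy, rfl⟩ := (PMF.mem_support_map_iff _ _ _).1 hz
    exact ⟨((hη x hx).2.1 y hy).1, add_le_add (h2 x hx).2 ((hη x hx).2.1 y hy).2⟩
  · intro K T hT
    rw [List.append_assoc, h3 _ T (by omega), PMF.bind_bind]
    refine bind_congr_support _ fun x hx => ?_
    rw [(hη x hx).2.2 K _ (by have := (h2 x hx).2; omega), PMF.bind_map]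
    simp only [Function.comp_def, Nat.sub_sub]

/-- One step with a random outcome. -/
theorem Exec.step_bind {X : Type} {cs' : List Cmd} {q : PMF X} {g : X → State} {ν : X → PMF A}
    (hs : ∀ K, step w I (cs ++ K, s) = q.map fun x => (cs' ++ K, g x))
    (h : ∀ x, Exec w I cs' (g x) t (ν x) R) : Exec w I cs s (t + 1) (q.bind ν) R := by
  choose κ h1 h2 h3 using h
  refine ⟨q.bind fun x => (κ x).map fun y => (y.1, y.2.1, y.2.2 + 1), ?_, ?_, ?_⟩
  · rw [PMF.map_bind]
    congr 1
    funext x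
    rw [PMF.map_comp, ← h1 x]
    rfl
  · intro z hz
    obtain ⟨x, hx, hz⟩ := (PMF.mem_support_bind_iff _ _ _).1 hz
    obtain ⟨y, hy, rfl⟩ := (PMF.mem_support_map_iff _ _ _).1 hz
    exact ⟨(h2 x y hy).1, Nat.add_le_add_right (h2 x y hy).2 1⟩
  · intro K T hT
    obtain ⟨T, rfl⟩ : ∃ T', T = T' + 1 := ⟨T - 1, by omega⟩
    rw [run, hs, PMF.bind_map, PMF.bind_bind]
    congr 1
    funext x
    rw [Function.comp_apply, h3 x K T (by omega), PMF.bind_map]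
    simp only [Function.comp_def, Nat.add_sub_add_right]

/-- One deterministic step. -/
theorem Exec.step_pure {cs' : List Cmd} {s' : State}
    (hs : ∀ K, step w I (cs ++ K, s) = PMF.pure (cs' ++ K, s'))
    (h : Exec w I cs' s' t μ R) : Exec w I cs s (t + 1) μ R := by
  have := Exec.step_bind (q := PMF.pure ()) (g := fun _ => s') (ν := fun _ => μ)
    (fun K => by rw [hs, PMF.pure_map]) fun _ => h
  rwa [PMF.pure_bind] at this

/-- Register `d` becomes `v`. -/
def State.put (s : State) (d v : ℕ) : State := { s with reg := Function.update s.reg d v }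

/-- The memory cell `a` becomes `v`. -/
def State.putMem (s : State) (a v : ℕ) : State := { s with mem := Function.update s.mem a v }

@[simp] theorem put_reg (d v r : ℕ) : (s.put d v).reg r = if r = d then v else s.reg r := by
  simp [State.put, Function.update_apply]

@[simp] theorem put_mem (d v : ℕ) : (s.put d v).mem = s.mem := rfl

@[simp] theorem putMem_reg (a v : ℕ) : (s.putMem a v).reg = s.reg := rfl

@[simp] theorem putMem_mem (a v b : ℕ) :
    (s.putMem a v).mem b = if b = a then v else s.mem b := by
  simp [State.putMem, Function.update_apply]

/-- In the absence of overflow, truncated writes are exact. The bounds against `2 ^ w` below all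
serve this purpose. -/
theorem setReg_eq_put {d v : ℕ} (h : v < 2 ^ w) : s.setReg w d v = s.put d v := by
  rw [State.setReg, State.put, Nat.mod_eq_of_lt h]

theorem setMem_eq_putMem {a v : ℕ} (h : v < 2 ^ w) : s.setMem w a v = s.putMem a v := by
  rw [State.setMem, State.putMem, Nat.mod_eq_of_lt h]

@[simp] theorem eval_reg (r : ℕ) : (Operand.reg r).eval s = s.reg r := rfl

@[simp] theorem eval_lit (v : ℕ) : (Operand.lit v).eval s = v := rfl

@[simp] theorem eval_add (x y : ℕ) : Arith.add.eval x y = x + y := rfl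

@[simp] theorem eval_mul (x y : ℕ) : Arith.mul.eval x y = x * y := rfl

@[simp] theorem eval_div (x y : ℕ) : Arith.div.eval x y = x / y := rfl

theorem Exec.arith {d : ℕ} {o : Arith} {a b : Operand} (v : ℕ)
    (hv : o.eval (a.eval s) (b.eval s) = v) (hw : v < 2 ^ w)
    (h : Exec w I cs (s.put d v) t μ R) : Exec w I (.arith d o a b :: cs) s (t + 1) μ R := by
  subst hv
  exact .step_pure (fun _ => by rw [← setReg_eq_put hw]; rfl) h

theorem Exec.load {d : ℕ} {a : Operand} (v : ℕ) (hv : s.mem (a.eval s) = v) (hw : v < 2 ^ w)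
    (h : Exec w I cs (s.put d v) t μ R) : Exec w I (.load d a :: cs) s (t + 1) μ R := by
  subst hv
  exact .step_pure (fun _ => by rw [← setReg_eq_put hw]; rfl) h

theorem Exec.store {a b : Operand} (x v : ℕ) (hx : a.eval s = x) (hv : b.eval s = v)
    (hw : v < 2 ^ w) (h : Exec w I cs (s.putMem x v) t μ R) :
    Exec w I (.store a b :: cs) s (t + 1) μ R := by
  subst hx hv
  exact .step_pure (fun _ => by rw [← setMem_eq_putMem hw]; rfl) h

theorem Exec.random [NeZero n] {d : ℕ} {a : Operand} (ha : a.eval s = n) (hn : n ≤ 2 ^ w)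
    {ν : Fin n → PMF A} (h : ∀ x : Fin n, Exec w I cs (s.put d x) t (ν x) R) :
    Exec w I (.random d a :: cs) s (t + 1) ((PMF.uniformOfFintype (Fin n)).bind ν) R := by
  refine .step_bind (fun K => ?_) h
  change (draw (a.eval s)).map (fun v => (cs ++ K, s.setReg w d v)) = _
  rw [ha, draw, dif_neg (NeZero.ne n), PMF.map_comp]
  congr 1
  funext x
  rw [Function.comp_apply, setReg_eq_put (x.2.trans_le hn)]

theorem Exec.cmp {d : ℕ} {a b : Operand} {x y : Fin n} (ha : a.eval s = x) (hb : b.eval s = y)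
    (hw : 1 < 2 ^ w) {ν : Bool → PMF A}
    (h : ∀ r : Bool, Exec w I cs (s.put d r.toNat) t (ν r) R) :
    Exec w I (.cmp d a b :: cs) s (t + 1) ((I.report x y).bind ν) R := by
  refine .step_bind (fun K => ?_) h
  change (I.answer (a.eval s) (b.eval s)).map (fun v => (cs ++ K, s.setReg w d v)) = _
  rw [ha, hb, Input.answer, dif_pos ⟨x.2, y.2⟩, PMF.map_comp]
  congr 1
  funext r
  rw [Function.comp_apply, setReg_eq_put ((Bool.toNat_le r).trans_lt hw)]

theorem Exec.ifLt {a b : Operand} {c₁ c₂ : Cmd}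
    (h : Exec w I ((if a.eval s < b.eval s then c₁ else c₂) :: cs) s t μ R) :
    Exec w I (.ifLt a b c₁ c₂ :: cs) s (t + 1) μ R :=
  .step_pure (fun _ => rfl) h

theorem Exec.while_exit {a b : Operand} {c : Cmd} (hc : b.eval s ≤ a.eval s)
    (h : Exec w I cs s t μ R) : Exec w I (.whileLt a b c :: cs) s (t + 1) μ R := by
  refine .step_pure (fun K => ?_) h
  change PMF.pure (if a.eval s < b.eval s then _ else _, s) = _
  rw [if_neg (not_lt.2 hc)]
  rfl

theorem Exec.while_enter {a b : Operand} {c : Cmd} (hc : a.eval s < b.eval s)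
    (h : Exec w I (c :: .whileLt a b c :: cs) s t μ R) :
    Exec w I (.whileLt a b c :: cs) s (t + 1) μ R := by
  refine .step_pure (fun K => ?_) h
  change PMF.pure (if a.eval s < b.eval s then _ else _, s) = _
  rw [if_pos hc]
  rfl

/-- The sequential composition of a list of commands. -/
def block : List Cmd → Cmd
  | [] => .skip
  | c :: l => .seq c (block l)

theorem Exec.block_nil (h : Exec w I cs s t μ R) : Exec w I (block [] :: cs) s (t + 1) μ R :=
  .step_pure (fun _ => rfl) h

theorem Exec.block_cons {c : Cmd} {l : List Cmd} (h : Exec w I (c :: block l :: cs) s t μ R) :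
    Exec w I (block (c :: l) :: cs) s (t + 1) μ R :=
  .step_pure (fun _ => rfl) h

theorem Exec.cons {c : Cmd} {t' : ℕ} {ν : A → PMF B} {R' : B → State → Prop}
    (h : Exec w I [c] s t μ R) (h' : ∀ a s', R a s' → Exec w I cs s' t' (ν a) R') :
    Exec w I (c :: cs) s (t + t') (μ.bind ν) R' :=
  h.append h'

/-- A computation with a deterministic result, followed by further commands. -/
theorem Exec.cons_pure {c : Cmd} {t' : ℕ} {ν : PMF B} {Q : State → Prop} {R' : B → State → Prop}
    (h : Exec w I [c] s t (PMF.pure ()) fun _ => Q) (h' : ∀ s', Q s' → Exec w I cs s' t' ν R') :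
    Exec w I (c :: cs) s (t + t') ν R' := by
  have := h.cons (ν := fun _ => ν) fun _ s' hs => h' s' hs
  rwa [PMF.pure_bind] at this

/-! ### The programs -/

/-- Count the reports "register `8` is smaller than register `9`" among as many comparisons as
register `4` tells. -/
def voteLoop : Cmd :=
  .whileLt (.reg 10) (.reg 4) (block [
    .cmp 12 (.reg 8) (.reg 9),
    .arith 11 .add (.reg 11) (.reg 12),
    .arith 10 .add (.reg 10) (.lit 1)])

/-- `N` counts the comparisons still to be made. That the votes never outnumber the comparisons made
keeps register `11` below the word bound. -/
theorem exec_voteLoop {x y : Fin n} {L : ℕ} (hL : L < 2 ^ w) (N : ℕ) (s : State)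
    (hx : s.reg 8 = x) (hy : s.reg 9 = y) (h4 : s.reg 4 = L) (h10 : s.reg 10 + N = L)
    (h11 : s.reg 11 ≤ s.reg 10) :
    Exec w I [voteLoop] s (8 * N + 1) ((I.votes x y N).map fun u => s.reg 11 + u)
      fun u s' => s'.reg 11 = u ∧ u ≤ L ∧ (∀ r < 10, s'.reg r = s.reg r) ∧ s'.mem = s.mem := by
  induction N generalizing s with
  | zero =>
    rw [Input.votes, PMF.pure_map]
    exact .while_exit (by simp; omega) (.nil ⟨rfl, by omega, fun _ _ => rfl, rfl⟩)
  | succ N ih =>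
    have e : ((I.votes x y (N + 1)).map fun u => s.reg 11 + u) =
        (I.report x y).bind fun b => (I.votes x y N).map fun u => s.reg 11 + b.toNat + u := by
      simp only [Input.votes, PMF.map_bind, PMF.map_comp, Function.comp_def]
      congr 1; funext b; congr 1; funext u; ring
    rw [e]
    refine .mono (.while_enter (by simp; omega) (.block_cons (.cmp (x := x) (y := y) (by simpa)
      (by simpa) (by omega) fun b => (?_ : Exec w I _ _ (8 * N + 6) _ _)))) (by omega)
      fun _ _ h => h
    have hb : b.toNat ≤ 1 := Bool.toNat_le b
    refine .mono (.block_cons (.arith (s.reg 11 + b.toNat) (by simp) (by omega) (.block_cons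
      (.arith (s.reg 10 + 1) (by simp) (by omega) (.block_nil
      (ih _ (by simpa) (by simpa) (by simpa) (by simp; omega) (by simp; omega))))))) (by omega) ?_
    rintro u s' ⟨h1, h2, h3, h4⟩
    refine ⟨h1, h2, fun r hr => ?_, by simpa using h4⟩
    rw [h3 r hr]
    simp [show r ≠ 10 by omega, show r ≠ 11 by omega, show r ≠ 12 by omega]

/-- The memory cells from address `a` on hold the elements of the list. -/
def Holds (mem : ℕ → ℕ) : ℕ → List (Fin n) → Prop
  | _, [] => True
  | a, x :: l => mem a = x ∧ Holds mem (a + 1) l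

theorem Holds.congr {mem mem' : ℕ → ℕ} {a : ℕ} {l : List (Fin n)} (h : Holds mem a l)
    (e : ∀ i, a ≤ i → mem' i = mem i) : Holds mem' a l := by
  induction l generalizing a with
  | nil => trivial
  | cons x l ih => exact ⟨(e a le_rfl).trans h.1, ih h.2 fun i hi => e i (by omega)⟩

/-- Play the match number `j` of a round, where register `6` contains `j`. -/
def matchBody : Cmd :=
  block [
    .arith 7 .add (.reg 6) (.reg 6),
    .load 8 (.reg 7),
    .arith 7 .add (.reg 7) (.lit 1),
    .load 9 (.reg 7),
    .arith 10 .add (.lit 0) (.lit 0),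
    .arith 11 .add (.lit 0) (.lit 0),
    voteLoop,
    .arith 11 .add (.reg 11) (.reg 11),
    .ifLt (.reg 4) (.reg 11) (.store (.reg 6) (.reg 8)) (.store (.reg 6) (.reg 9)),
    .arith 6 .add (.reg 6) (.lit 1)]

theorem exec_matchBody {x y : Fin n} {L j : ℕ} (hL : 2 * L < 2 ^ w) (hn : n ≤ 2 ^ w) (s : State)
    (h4 : s.reg 4 = L) (h6 : s.reg 6 = j) (hj : 2 * j + 1 < 2 ^ w)
    (hx : s.mem (2 * j) = x) (hy : s.mem (2 * j + 1) = y) :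
    Exec w I [matchBody] s (8 * L + 23) (I.majority L x y)
      fun u s' => s'.reg 6 = j + 1 ∧ s'.mem j = u ∧ (∀ i, i ≠ j → s'.mem i = s.mem i) ∧
        ∀ r < 6, s'.reg r = s.reg r := by
  have hxw : (x : ℕ) < 2 ^ w := x.2.trans_le hn
  have hyw : (y : ℕ) < 2 ^ w := y.2.trans_le hn
  rw [Input.majority, ← PMF.bind_pure_comp]
  refine .mono (.block_cons (.arith (2 * j) (by simp [h6, two_mul]) (by omega)
    (.block_cons (.load x (by simp [hx]) hxw
    (.block_cons (.arith (2 * j + 1) (by simp) hj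
    (.block_cons (.load y (by simp [hy]) hyw
    (.block_cons (.arith 0 (by simp) (by omega)
    (.block_cons (.arith 0 (by simp) (by omega)
    (.block_cons (.cons (.congr_law (exec_voteLoop (x := x) (y := y) (L := L) (by omega) L _
      (by simp) (by simp) (by simpa) (by simp) (by simp)) (by simp; exact PMF.map_id _))
      fun v s' hs => (?_ : Exec w I _ _ 8 _ _))))))))))))))) (by omega) fun _ _ h => h
  obtain ⟨h11, hv, hr, hm⟩ := hs
  have h8 : s'.reg 8 = x := by simp [hr]
  have h9 : s'.reg 9 = y := by simp [hr]
  have h4' : s'.reg 4 = L := by simp [hr, h4]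
  have h6' : s'.reg 6 = j := by simp [hr, h6]
  have hlow : ∀ r < 6, s'.reg r = s.reg r := by
    intro r h
    rw [hr r (by omega)]
    simp [show r ≠ 7 by omega, show r ≠ 8 by omega, show r ≠ 9 by omega,
      show r ≠ 10 by omega, show r ≠ 11 by omega]
  refine .mono (.block_cons (.arith (2 * v) (by simp [h11, two_mul]) (by omega)
    (.block_cons (.ifLt (t := 4) ?_)))) (by omega) fun _ _ h => h
  by_cases hlt : L < 2 * v
  · rw [if_pos (by simpa [h4']), Function.comp_apply, if_pos hlt]
    refine .store j x (by simp [h6']) (by simp [h8]) hxw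
      (.block_cons (.arith (j + 1) (by simp [h6']) (by omega)
        (.block_nil (.nil ⟨by simp, by simp, fun i hi => by simp [hi, hm], fun r h => ?_⟩))))
    simp [hlow r h, show r ≠ 6 by omega, show r ≠ 11 by omega]
  · rw [if_neg (by simpa [h4'] using hlt), Function.comp_apply, if_neg hlt]
    refine .store j y (by simp [h6']) (by simp [h9]) hyw
      (.block_cons (.arith (j + 1) (by simp [h6']) (by omega)
        (.block_nil (.nil ⟨by simp, by simp, fun i hi => by simp [hi, hm], fun r h => ?_⟩))))
    simp [hlow r h, show r ≠ 6 by omega, show r ≠ 11 by omega]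

/-- Play the matches of a round. -/
def playLoop : Cmd := .whileLt (.reg 6) (.reg 5) matchBody

/-- A round can be played in place: the winner of match `j` goes to cell `j`, while the contestants
still to play occupy the cells from `2 * (j + 1)` on. -/
theorem exec_playLoop {L : ℕ} (hL : 2 * L < 2 ^ w) (hn : n ≤ 2 ^ w) (q : ℕ) (l : List (Fin n))
    (hl : l.length = 2 * q) (s : State) (h4 : s.reg 4 = L) (h5 : s.reg 5 = s.reg 6 + q)
    (hm : 2 * s.reg 5 < 2 ^ w) (hh : Holds s.mem (2 * s.reg 6) l) :
    Exec w I [playLoop] s (q * (8 * L + 24) + 1) (I.play L l)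
      fun l' s' => l'.length = q ∧ Holds s'.mem (s.reg 6) l' ∧
        (∀ i < s.reg 6, s'.mem i = s.mem i) ∧ ∀ r < 6, s'.reg r = s.reg r := by
  induction q generalizing l s with
  | zero =>
    obtain rfl : l = [] := List.length_eq_zero_iff.1 (by omega)
    refine .mono (.while_exit (by simp; omega) (.nil ?_)) (by omega) fun _ _ h => h
    exact ⟨rfl, trivial, fun _ _ => rfl, fun _ _ => rfl⟩
  | succ q ih =>
    obtain ⟨x, y, l, rfl⟩ : ∃ x y l', l = x :: y :: l' := by
      match l, hl with
      | x :: y :: l', _ => exact ⟨x, y, l', rfl⟩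
      | [_], h => simp at h; omega
      | [], h => simp at h
    rw [Input.play]
    obtain ⟨hx, hy, hh⟩ := hh
    refine .mono (.while_enter (by simp; omega) (.cons (exec_matchBody (x := x) (y := y) hL hn s h4
      rfl (by omega) hx hy) (t' := q * (8 * L + 24) + 1) fun u s' hs => ?_))
      (by ring_nf; omega) fun _ _ h => h
    obtain ⟨h6', hu, hmem, hreg⟩ := hs
    refine (ih l (by simp at hl; omega) s' (by rw [hreg _ (by omega), h4])
      (by rw [hreg _ (by omega)]; omega) (by rw [hreg _ (by omega)]; omega) ?_).map _ ?_
    · rw [h6']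
      exact hh.congr fun i hi => hmem i (by omega)
    · rintro l' s'' ⟨h1, h2, h3, h7⟩
      rw [h6'] at h2 h3
      refine ⟨by simp [h1], ⟨?_, h2⟩, fun i hi => ?_, fun r hr => ?_⟩
      · rw [h3 _ (by omega), hu]
      · rw [h3 i (by omega), hmem i (by omega)]
      · rw [h7 r hr, hreg r hr]

/-- Play a round with `2 * c * t + 5` comparisons per match, where the parameter `t`, in register
`3`, is updated beforehand. -/
def roundBody (c : ℕ) (o : Arith) (d : ℕ) : Cmd :=
  block [
    .arith 3 o (.reg 3) (.lit d),
    .arith 4 .mul (.lit (2 * c)) (.reg 3),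
    .arith 4 .add (.reg 4) (.lit 5),
    .arith 5 .div (.reg 2) (.lit 2),
    .arith 6 .add (.lit 0) (.lit 0),
    playLoop,
    .arith 2 .add (.reg 5) (.lit 0)]

/-- Play rounds until the number of contestants does not exceed the bound `b`. -/
def roundsLoop (c : ℕ) (o : Arith) (d : ℕ) (b : Operand) : Cmd :=
  .whileLt b (.reg 2) (roundBody c o d)

theorem exec_roundBody {o : Arith} {d : ℕ} (hn : n ≤ 2 ^ w) (s : State) (q : ℕ)
    (hq : 2 * q < 2 ^ w) (h2 : s.reg 2 = 2 * q) (l : List (Fin n)) (hl : l.length = 2 * q)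
    (hh : Holds s.mem 0 l) {t' L : ℕ} (ht' : o.eval (s.reg 3) d = t')
    (hL : 2 * boostConst p * t' + 5 = L) (ht : t' < 2 ^ w) (hLw : 2 * L < 2 ^ w) :
    Exec w I [roundBody (boostConst p) o d] s (q * (8 * L + 24) + 15) (I.play L l)
      fun l' s' => l'.length = q ∧ Holds s'.mem 0 l' ∧ s'.reg 2 = q ∧ s'.reg 3 = t' ∧
        ∀ r < 2, s'.reg r = s.reg r := by
  rw [← PMF.bind_pure (I.play L l)]
  refine .mono (.block_cons (.arith t' (by simpa) ht
    (.block_cons (.arith (2 * boostConst p * t') (by simp) (by omega)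
    (.block_cons (.arith L (by simpa) (by omega)
    (.block_cons (.arith q (by simp [h2]) (by omega)
    (.block_cons (.arith 0 (by simp) (by omega)
    (.block_cons (.cons (exec_playLoop (L := L) hLw hn q l hl _ (by simp) (by simp) (by simpa)
      (by simpa)) fun l' s' hs => .block_cons (.arith q (by simp [hs.2.2.2]) (by omega)
      (.block_nil (.nil ?_))))))))))))))) (by omega) fun _ _ h => h
  obtain ⟨h1, h3, -, h5⟩ := hs
  refine ⟨h1, by simpa using h3, by simp, by simp [h5], fun r hr => ?_⟩
  simp [h5 r (by omega), show r ≠ 2 by omega, show r ≠ 3 by omega, show r ≠ 4 by omega,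
    show r ≠ 5 by omega, show r ≠ 6 by omega]

/-- An upper bound for the running time of `r` rounds that leave `m` contestants. -/
def roundsCost (c : ℕ) (f : ℕ → ℕ) (m : ℕ) : ℕ → ℕ → ℕ
  | _, 0 => 1
  | t, r + 1 => m * 2 ^ r * (8 * (2 * c * f t + 5) + 24) + 16 + roundsCost c f m (f t) r

/-- `T` bounds all match parameters at once, which excludes overflow in every round. The stopping
bound is a constant or register `1`, which rounds leave intact. -/
theorem exec_roundsLoop {o : Arith} {d m T : ℕ} {b : Operand} (hn : n ≤ 2 ^ w)
    (hm0 : 0 < m) (hT : T < 2 ^ w) (hTw : 2 * (2 * boostConst p * T + 5) < 2 ^ w) (r : ℕ)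
    (l : List (Fin n))
    (hl : l.length = m * 2 ^ r) (s : State) (hm : m * 2 ^ r < 2 ^ w)
    (hb : b = .lit m ∨ b = .reg 1 ∧ s.reg 1 = m) (h2 : s.reg 2 = m * 2 ^ r) (hh : Holds s.mem 0 l)
    (hf : ∀ i < r, (fun t => o.eval t d)^[i + 1] (s.reg 3) ≤ T) :
    Exec w I [roundsLoop (boostConst p) o d b] s
      (roundsCost (boostConst p) (fun t => o.eval t d) m (s.reg 3) r)
      (I.playFrom (fun t => o.eval t d) (s.reg 3) r l)
      fun l' s' => l'.length = m ∧ Holds s'.mem 0 l' ∧ s'.reg 2 = m ∧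
        ∀ r < 2, s'.reg r = s.reg r := by
  induction r generalizing l s with
  | zero =>
    have hbe : b.eval s = m := by
      rcases hb with rfl | ⟨rfl, h⟩
      · rfl
      · exact h
    exact .while_exit (by simp [hbe, h2]) (.nil ⟨by simpa using hl, hh, by simpa using h2,
      fun _ _ => rfl⟩)
  | succ r ih =>
    have hbe : b.eval s = m := by
      rcases hb with rfl | ⟨rfl, h⟩
      · rfl
      · exact h
    have hr : m * 2 ^ (r + 1) = 2 * (m * 2 ^ r) := by ring
    have hr1 : m ≤ m * 2 ^ r := Nat.le_mul_of_pos_right _ (by positivity)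
    have ht : o.eval (s.reg 3) d ≤ T := hf 0 (by omega)
    have hL : 2 * (2 * boostConst p * o.eval (s.reg 3) d + 5) < 2 ^ w :=
      lt_of_le_of_lt (by gcongr) hTw
    refine .mono (.while_enter (by rw [hbe, eval_reg, h2]; omega) (.cons (exec_roundBody hn s
      (m * 2 ^ r) (by omega) (by omega) l (by omega) hh rfl rfl (by omega) hL)
      (t' := roundsCost (boostConst p) (fun t => o.eval t d) m (o.eval (s.reg 3) d) r)
      fun l' s' hs => ?_)) ?_ fun _ _ h => h
    · obtain ⟨h1, h3, h4, h5, h6⟩ := hs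
      beta_reduce
      rw [← h5]
      refine (ih l' h1 s' (by omega) (hb.imp_right fun h => ⟨h.1, (h6 1 (by omega)).trans h.2⟩)
        h4 h3 fun i hi => ?_).mono le_rfl ?_
      · rw [h5]
        exact hf (i + 1) (by omega)
      · rintro l'' s'' ⟨g1, g2, g3, g4⟩
        exact ⟨g1, g2, g3, fun r hr => (g4 r hr).trans (h6 r hr)⟩
    · rw [roundsCost]
      beta_reduce
      omega

/-- Fill the memory with as many random positions as register `2` tells. -/
def fillLoop : Cmd :=
  .whileLt (.reg 6) (.reg 2) (block [
    .random 7 (.reg 0),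
    .store (.reg 6) (.reg 7),
    .arith 6 .add (.reg 6) (.lit 1)])

theorem exec_fillLoop [NeZero n] (hn : n ≤ 2 ^ w) (q : ℕ) (s : State) (h0 : s.reg 0 = n)
    (h2 : s.reg 2 = s.reg 6 + q) (hw : s.reg 2 < 2 ^ w) :
    Exec w I [fillLoop] s (8 * q + 1) (samples n q)
      fun l s' => l.length = q ∧ Holds s'.mem (s.reg 6) l ∧
        (∀ i < s.reg 6, s'.mem i = s.mem i) ∧ ∀ r < 6, s'.reg r = s.reg r := by
  induction q generalizing s with
  | zero =>
    exact .while_exit (by simp; omega) (.nil ⟨rfl, trivial, fun _ _ => rfl, fun _ _ => rfl⟩)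
  | succ q ih =>
    refine .mono (.while_enter (by simp; omega) (.block_cons (.random (by simpa) hn fun x =>
      .block_cons (.store (s.reg 6) x (by simp) (by simp) (x.2.trans_le hn)
      (.block_cons (.arith (s.reg 6 + 1) (by simp) (by omega) (.block_nil
      (.map (ih _ (by simpa) (by simp; omega) (by simpa)) (fun l => x :: l) ?_)))))))) (by omega)
      fun _ _ h => h
    rintro l s' ⟨h1, h3, h4, h5⟩
    simp only [put_reg, putMem_reg, put_mem, putMem_mem, reduceIte] at h3 h4 h5
    refine ⟨by simp [h1], ⟨?_, h3⟩, fun i hi => ?_, fun r hr => ?_⟩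
    · rw [h4 _ (by omega), if_pos rfl]
    · rw [h4 i (by omega), if_neg (by omega)]
    · rw [h5 r hr, if_neg (by omega), if_neg (by omega)]

end Exec

/-! ### The two-phase tournament as a program -/

section Programs

variable {α : Type u} [LinearOrder α] {n : ℕ} {p : ℝ} {A : Type}
  {w : ℕ} {I : Input α n p} {s : State} {t : ℕ}

theorem iterate_succ (i x : ℕ) : (fun t => t + 1)^[i] x = x + i := by
  induction i with
  | zero => rfl
  | succ i ih => rw [Function.iterate_succ_apply', ih, add_assoc]

theorem iterate_double (i x : ℕ) : (fun t => t * 2)^[i] x = x * 2 ^ i := by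
  induction i with
  | zero => simp
  | succ i ih => rw [Function.iterate_succ_apply', ih, pow_succ, mul_assoc]

/-- Fill the memory with random positions and play a tournament, first with match lengths that
grow slowly until the number of contestants is down to register `1`, then with match lengths that
are doubled from round to round. -/
def tournament (c : ℕ) : Cmd :=
  block [
    fillLoop,
    .arith 3 .add (.lit 1) (.lit 0),
    roundsLoop c .add 1 (.reg 1),
    .arith 3 .add (.lit 1) (.lit 0),
    roundsLoop c .mul 2 (.lit 1),
    .load 0 (.lit 0)]

theorem exec_tournament [NeZero n] {h r T : ℕ} (hn : n ≤ 2 ^ w) (hT : 2 ^ h * 2 ^ r = T)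
    (hTw : T < 2 ^ w) (hLw : 2 * (2 * boostConst p * T + 5) < 2 ^ w) (s : State)
    (h0 : s.reg 0 = n) (h1 : s.reg 1 = 2 ^ h) (h2 : s.reg 2 = T) (h6 : s.reg 6 = 0) :
    Exec w I [tournament (boostConst p)] s
      (8 * T + roundsCost (boostConst p) (fun t => t + 1) (2 ^ h) 1 r +
        roundsCost (boostConst p) (fun t => t * 2) 1 1 h + 11)
      (I.champion (fun t => t * 2) 1 h
        (I.champion (fun t => t + 1) 1 r (PMF.uniformOfFintype (Fin n))))
      fun i s' => s'.reg 0 = i := by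
  have law : (samples n T).bind (fun l => (I.playFrom (fun t => t + 1) 1 r l).bind fun l' =>
      (I.playFrom (fun t => t * 2) 1 h l').bind fun l'' => PMF.pure (l''.headD 0)) =
      I.champion (fun t => t * 2) 1 h
        (I.champion (fun t => t + 1) 1 r (PMF.uniformOfFintype (Fin n))) := by
    rw [← PMF.bind_bind, samples_eq_iid, ← hT, iid_bind_playFrom, ← PMF.bind_bind,
      ← one_mul (2 ^ h), iid_bind_playFrom]
    exact iid_one_map_headD _
  -- Slow parameters are at most `r + 1 ≤ 2 ^ r` and doubled ones at most `2 ^ h`, so the number `T`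
  -- of contestants bounds both.
  have hr : r < 2 ^ r := Nat.lt_two_pow_self
  have hh1 : 1 ≤ 2 ^ h := Nat.one_le_two_pow
  have hrT : 2 ^ r ≤ T := hT ▸ Nat.le_mul_of_pos_left _ hh1
  have hhT : 2 ^ h ≤ T := hT ▸ Nat.le_mul_of_pos_right _ (by positivity)
  rw [← law]
  refine .mono (.block_cons (.cons (exec_fillLoop hn T s h0 (by omega) (by omega))
    (t' := roundsCost (boostConst p) (fun t => t + 1) (2 ^ h) 1 r +
        roundsCost (boostConst p) (fun t => t * 2) 1 1 h + 9) fun l s1 hs1 => ?_)) (by omega)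
    fun _ _ h => h
  obtain ⟨a1, a2, -, a3⟩ := hs1
  rw [h6] at a2
  have b0 : ∀ i < r, (fun t => Arith.add.eval t 1)^[i + 1] ((s1.put 3 1).reg 3) ≤ T := by
    intro i hi
    simp only [eval_add, iterate_succ, put_reg, reduceIte]
    omega
  refine .mono (.block_cons (.arith 1 (by simp) (by omega) (.block_cons (.cons
    (exec_roundsLoop (o := .add) (d := 1) (m := 2 ^ h) (T := T) (b := .reg 1) hn (by omega) hTw hLw
      r l (by omega) _ (by omega) (.inr ⟨rfl, by simp [a3, h1]⟩) (by simp [a3, h2, hT])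
      (by simpa) b0)
    (t' := roundsCost (boostConst p) (fun t => t * 2) 1 1 h + 6) fun l' s2 hs2 => ?_))))
    ?_ fun _ _ h => h
  · obtain ⟨c1, c2, c3, c4⟩ := hs2
    have d0 : ∀ i < h, (fun t => Arith.mul.eval t 2)^[i + 1] ((s2.put 3 1).reg 3) ≤ T := by
      intro i hi
      simp only [eval_mul, iterate_double, put_reg, reduceIte, one_mul]
      exact (Nat.pow_le_pow_right (by omega) (by omega)).trans hhT
    refine .mono (.block_cons (.arith 1 (by simp) (by omega) (.block_cons (.cons
      (exec_roundsLoop (o := .mul) (d := 2) (m := 1) (T := T) (b := .lit 1) hn (by omega) hTw hLw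
        h l' (by omega) _ (by omega) (.inl rfl) (by simp [c3]) (by simpa) d0)
      (t' := 3) fun l'' s3 hs3 => ?_)))) ?_ fun _ _ h => h
    · obtain ⟨e1, e2, -, -⟩ := hs3
      obtain ⟨x, rfl⟩ := List.length_eq_one_iff.1 e1
      refine .block_cons (.load x (by simpa using e2.1) (x.2.trans_le hn)
        (.block_nil (.nil (by simp))))
    · simp
  · simp
    omega

/-! ### Running times of the two phases -/

/-- Matches halve in number as their parameter doubles: `m * 2 ^ r * t` is invariant and bounds each
of the `r` rounds up to a constant. -/
theorem roundsCost_double_le (c m t r : ℕ) (hm : 1 ≤ m) (ht : 1 ≤ t) :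
    roundsCost c (fun t => t * 2) m t r ≤ r * (m * 2 ^ r * t * (16 * c + 48)) + 1 := by
  induction r generalizing t with
  | zero => simp [roundsCost]
  | succ r ih =>
    rw [roundsCost]
    have := ih (t * 2) (by omega)
    have h2 : 1 ≤ m * 2 ^ r := Nat.mul_pos hm (by positivity)
    have e : m * 2 ^ (r + 1) * t = m * 2 ^ r * (t * 2) := by ring
    have h3 : m * 2 ^ r ≤ m * 2 ^ r * t := Nat.le_mul_of_pos_right _ ht
    rw [e]
    nlinarith

/-- The halving field beats the linear growth of `t`, so no factor `r` appears. The potential `t +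
3` works because `2 * (t + 3) = (t + 4) + (t + 2)`, where `t + 4` belongs to the later rounds and `t
+ 2` pays for the current one. -/
theorem roundsCost_succ_le (c m t r : ℕ) (hm : 1 ≤ m) :
    roundsCost c (fun t => t + 1) m t r ≤ (16 * c + 80) * (m * 2 ^ r) * (t + 3) := by
  induction r generalizing t with
  | zero =>
    rw [roundsCost]
    exact Nat.mul_pos (Nat.mul_pos (by omega) (Nat.mul_pos hm (by positivity))) (by omega)
  | succ r ih =>
    rw [roundsCost]
    have := ih (t + 1)
    have h2 : 1 ≤ m * 2 ^ r := Nat.mul_pos hm (by positivity)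
    have e : m * 2 ^ (r + 1) = 2 * (m * 2 ^ r) := by ring
    rw [e]
    generalize m * 2 ^ r = x at *
    have : 0 ≤ c * x * t := by positivity
    have : 0 ≤ c * x := by positivity
    have : 0 ≤ x * t := by positivity
    nlinarith

/-! ### From executions to outputs, and the word length -/

/-- What the execution of a program says about its output. -/
theorem Exec.output {P : Cmd} {c k T : ℕ} {μ : PMF (Fin n)}
    (h : Exec (wordLength c n) I [P] (start P n k).2 t μ fun i s' => s'.reg 0 = i) (hT : t ≤ T) :
    HaltsWithin P c I k T ∧ outputLaw P c I k T = μ.map Fin.val := by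
  obtain ⟨κ, h1, h2, h3⟩ := h
  have halted : ∀ (T : ℕ) (s : State), run (wordLength c n) I T ([], s) = PMF.pure ([], s) := by
    intro T s
    induction T with
    | zero => rfl
    | succ T ih => rw [run, step, PMF.pure_bind, ih]
  have hrun : runInput P c I k T = κ.map fun x => ([], x.2.1) := by
    have := h3 [] T hT
    simp only [halted] at this
    exact this
  constructor
  · intro cfg hcfg
    rw [hrun] at hcfg
    obtain ⟨x, -, rfl⟩ := (PMF.mem_support_map_iff _ _ _).1 hcfg
    rfl
  · rw [outputLaw, hrun, ← h1, PMF.map_comp, PMF.map_comp]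
    exact bind_congr_support _ fun x hx => congrArg PMF.pure (h2 x hx).1

theorem Exec.solves {P : Cmd} {c k T : ℕ} {μ : PMF (Fin n)} {δ : ℝ≥0∞}
    (h : Exec (wordLength c n) I [P] (start P n k).2 t μ fun i s' => s'.reg 0 = i) (hT : t ≤ T)
    (hμ : μ.toOuterMeasure {i | ¬ I.IsSmall k i} ≤ δ) : Solves P c I k T δ := by
  refine ⟨(h.output hT).1, ?_⟩
  rw [(h.output hT).2, PMF.toOuterMeasure_map_apply]
  refine le_trans (MeasureTheory.measure_mono fun i hi => ?_) hμ
  exact fun hs => hi ⟨i, rfl, hs⟩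

/-- Two of the `a + 2` blocks of `n.size` bits hold `n ^ 2`, the others the constant. All quantities
computed are `O(n ^ 2)`. -/
theorem le_two_pow_wordLength (a n : ℕ) : (a + 1) * n ^ 2 ≤ 2 ^ wordLength (a + 2) n := by
  rcases Nat.eq_zero_or_pos n with rfl | hn
  · simp
  have hs : 1 ≤ n.size := Nat.size_pos.2 hn
  calc (a + 1) * n ^ 2 ≤ 2 ^ (a * n.size) * (2 ^ n.size) ^ 2 := by
        gcongr
        · exact Nat.lt_two_pow_self.trans_le
            (Nat.pow_le_pow_right (by norm_num) (Nat.le_mul_of_pos_right _ hs))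
        · exact (Nat.lt_size_self n).le
    _ = _ := by rw [wordLength, ← pow_mul, ← pow_add]; congr 1; ring

/-- The program that plays the knockout tournament. -/
def knockoutProgram (c : ℕ) : Cmd :=
  block [
    .arith 1 .add (.reg 0) (.lit 0),
    .arith 2 .add (.reg 0) (.lit 0),
    tournament c]

/-- The knockout is the two-phase tournament with `r = 0`: register `1` is set to the full number of
contestants, so the slow phase is empty. -/
theorem exec_knockoutProgram {h k : ℕ} {I : Input α (2 ^ h) p} :
    Exec (wordLength (128 * boostConst p + 66) (2 ^ h)) I [knockoutProgram (boostConst p)]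
      (start (knockoutProgram (boostConst p)) (2 ^ h) k).2
      ((80 * boostConst p + 450) * 2 ^ h + (16 * boostConst p + 48) * (h * 2 ^ h))
      (I.knockout h) fun i s' => s'.reg 0 = i := by
  have hw := le_two_pow_wordLength (128 * boostConst p + 64) (2 ^ h)
  have h1 : 1 ≤ 2 ^ h := Nat.one_le_two_pow
  have h2 : 2 ^ h ≤ (2 ^ h) ^ 2 := by nlinarith
  have h3 : 2 ^ h < 2 ^ wordLength (128 * boostConst p + 66) (2 ^ h) := by
    refine lt_of_lt_of_le ?_ hw
    nlinarith
  have h4 : 2 * (2 * boostConst p * 2 ^ h + 5) <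
      2 ^ wordLength (128 * boostConst p + 66) (2 ^ h) := by
    refine lt_of_lt_of_le ?_ hw
    nlinarith
  rw [knockout_eq_champion, ← PMF.bind_pure (I.champion _ _ _ _)]
  refine .mono (.block_cons (.arith (2 ^ h) (by simp [start]) h3
    (.block_cons (.arith (2 ^ h) (by simp [start]) h3
    (.block_cons (.cons (exec_tournament (h := h) (r := 0) h3.le (by simp) h3 h4 _
      (by simp [start]) (by simp) (by simp) (by simp [start]))
      fun i s' hs => .block_nil (.nil hs))))))) ?_ fun _ _ h => h
  have c1 := roundsCost_succ_le (boostConst p) (2 ^ h) 1 0 h1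
  have c2 := roundsCost_double_le (boostConst p) 1 1 h le_rfl le_rfl
  nlinarith

/-- The knockout program runs in time `O(n log n)`. -/
theorem knockoutProgram_solves (p : ℝ) (hp0 : 0 ≤ p) (hp : p < 1 / 2) :
    ∃ (P : Cmd) (c : ℕ) (C : ℝ),
      ∀ (α : Type u) [LinearOrder α] (n h k : ℕ) (I : Input α (2 ^ h) p),
        n = 2 ^ h → 1 ≤ h → 3 * n ≤ 4 * k → k ≤ n →
          Solves P c I k ⌊C * (n * Real.logb 2 n)⌋₊ ((2⁻¹ : ℝ≥0∞) ^ (n + 1)) ∧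
          outputLaw P c I k ⌊C * (n * Real.logb 2 n)⌋₊ = (I.knockout h).map Fin.val := by
  refine ⟨knockoutProgram (boostConst p), 128 * boostConst p + 66,
    (96 * boostConst p + 498 : ℕ), ?_⟩
  rintro α _ n h k I rfl hh hk -
  have hT : (80 * boostConst p + 450) * 2 ^ h + (16 * boostConst p + 48) * (h * 2 ^ h) ≤
      ⌊((96 * boostConst p + 498 : ℕ) : ℝ) * ((2 ^ h : ℕ) * Real.logb 2 (2 ^ h : ℕ))⌋₊ := by
    have e : Real.logb 2 (2 ^ h : ℕ) = h := by
      rw [Nat.cast_pow, Nat.cast_ofNat, Real.logb_pow, Real.logb_self_eq_one (by norm_num),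
        mul_one]
    rw [e]
    apply Nat.le_floor
    have h1 : 2 ^ h ≤ h * 2 ^ h := Nat.le_mul_of_pos_left _ hh
    have h2 : (80 * boostConst p + 450) * 2 ^ h + (16 * boostConst p + 48) * (h * 2 ^ h) ≤
        (96 * boostConst p + 498) * (2 ^ h * h) := by nlinarith
    exact_mod_cast h2
  exact ⟨exec_knockoutProgram.solves hT (knockout_failure hp0 hp h k I hk),
    (exec_knockoutProgram.output hT).2⟩

/-! ### Computing the parameters and solving FT-Min(k) -/

/-- Double register `a` until it reaches register `b`, updating register `d` along the way. -/
def doublingLoop (a b d : ℕ) (o : Arith) (e : ℕ) : Cmd :=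
  .whileLt (.reg a) (.reg b) (block [
    .arith a .mul (.reg a) (.lit 2),
    .arith d o (.reg d) (.lit e)])

theorem exec_doublingLoop {a b d e : ℕ} {o : Arith} (hab : a ≠ b) (had : a ≠ d) (hbd : b ≠ d)
    (r : ℕ) (s : State) (hr : s.reg b ≤ s.reg a * 2 ^ r) (hlt : ∀ i < r, s.reg a * 2 ^ i < s.reg b)
    (hw : s.reg a * 2 ^ r < 2 ^ w)
    (ho : ∀ i < r, (fun t => o.eval t e)^[i + 1] (s.reg d) < 2 ^ w) :
    Exec w I [doublingLoop a b d o e] s (6 * r + 1) (PMF.pure ()) fun _ s' =>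
      s'.reg a = s.reg a * 2 ^ r ∧ s'.reg d = (fun t => o.eval t e)^[r] (s.reg d) ∧
        ∀ i, i ≠ a → i ≠ d → s'.reg i = s.reg i := by
  induction r generalizing s with
  | zero => exact .while_exit (by simpa using hr) (.nil ⟨by simp, rfl, fun _ _ _ => rfl⟩)
  | succ r ih =>
    have h0 : s.reg a < s.reg b := by simpa using hlt 0 (by omega)
    have h2 : s.reg a * 2 ^ (r + 1) = s.reg a * 2 * 2 ^ r := by ring
    have h3 : s.reg a * 2 ≤ s.reg a * 2 * 2 ^ r := Nat.le_mul_of_pos_right _ (by positivity)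
    refine .mono (.while_enter (by simpa) (.block_cons (.arith (s.reg a * 2) (by simp) (by omega)
      (.block_cons (.arith (o.eval (s.reg d) e) (by simp [had.symm]) (ho 0 (by omega))
      (.block_nil (ih _ ?_ ?_ ?_ ?_))))))) (by omega) ?_
    · simp [had, hab.symm, hbd, ← h2, hr]
    · intro i hi
      have := hlt (i + 1) (by omega)
      rw [pow_succ'] at this
      simpa [had, hab.symm, hbd, mul_assoc] using this
    · simp [had, ← h2, hw]
    · intro i hi
      simpa using ho (i + 1) (by omega)
    · rintro - s' ⟨h3, h4, h5⟩
      refine ⟨by simpa [had, h2] using h3, by simpa using h4, fun i hia hid => ?_⟩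
      simp [h5 i hia hid, hia, hid]

/-- The program for FT-Min(k). -/
def minProgram (c : ℕ) : Cmd :=
  block [
    .arith 3 .add (.lit 1) (.lit 0),
    doublingLoop 3 0 4 .add 1,
    .arith 2 .add (.lit 1) (.lit 0),
    doublingLoop 2 4 7 .add 0,
    .arith 5 .mul (.reg 0) (.lit 4),
    .arith 6 .add (.reg 1) (.lit 0),
    .arith 1 .add (.reg 2) (.lit 0),
    doublingLoop 6 5 2 .mul 2,
    .arith 6 .add (.lit 0) (.lit 0),
    tournament c]

theorem exists_least_two_pow_mul {a : ℕ} (ha : 0 < a) (b : ℕ) :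
    ∃ r, b ≤ a * 2 ^ r ∧ ∀ i < r, a * 2 ^ i < b := by
  have h : ∃ r, b ≤ a * 2 ^ r :=
    ⟨b, Nat.lt_two_pow_self.le.trans (Nat.le_mul_of_pos_left _ ha)⟩
  exact ⟨Nat.find h, Nat.find_spec h, fun i hi => not_le.1 (Nat.find_min h hi)⟩

/-- Logarithms are found by repeated doubling: the loops determine the least `j`, `h`, `r` with `n ≤
2 ^ j`, `j ≤ 2 ^ h`, `4 * n ≤ k * 2 ^ r`. The last one turns `2 ^ h` into `T` along the way; in the
second, register `7` is a dummy. -/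
theorem exec_minProgram [NeZero n] {j h r k T : ℕ}
    (hj : n ≤ 1 * 2 ^ j) (hj' : ∀ i < j, 1 * 2 ^ i < n)
    (hh : j ≤ 1 * 2 ^ h) (hh' : ∀ i < h, 1 * 2 ^ i < j)
    (hr : 4 * n ≤ k * 2 ^ r) (hr' : ∀ i < r, k * 2 ^ i < 4 * n)
    (hT : 2 ^ h * 2 ^ r = T) (hTw : T < 2 ^ w) (hLw : 2 * (2 * boostConst p * T + 5) < 2 ^ w)
    (hjw : 2 ^ j < 2 ^ w) (hrw : k * 2 ^ r < 2 ^ w) :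
    Exec w I [minProgram (boostConst p)] (start (minProgram (boostConst p)) n k).2
      (6 * j + 6 * h + 6 * r + 8 * T + roundsCost (boostConst p) (fun t => t + 1) (2 ^ h) 1 r +
        roundsCost (boostConst p) (fun t => t * 2) 1 1 h + 50)
      (I.champion (fun t => t * 2) 1 h
        (I.champion (fun t => t + 1) 1 r (PMF.uniformOfFintype (Fin n))))
      fun i s' => s'.reg 0 = i := by
  have hhT : 2 ^ h ≤ T := hT ▸ Nat.le_mul_of_pos_right _ (by positivity)
  have hjj : j < 2 ^ j := Nat.lt_two_pow_self
  have h0 : 0 < 2 ^ j := by positivity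
  set s0 := (start (minProgram (boostConst p)) n k).2 with hs0
  have e0 : s0.reg 0 = n := rfl
  have e1 : s0.reg 1 = k := rfl
  have e4 : s0.reg 4 = 0 := rfl
  have e7 : s0.reg 7 = 0 := rfl
  clear_value s0
  rw [← PMF.bind_pure (I.champion _ _ _ _)]
  refine .mono (.block_cons (.arith 1 (by simp) (by omega) (.block_cons (.cons_pure
    (exec_doublingLoop (by omega) (by omega) (by omega) j _ (by simpa [e0] using hj)
      (by simpa [e0] using hj') (by simpa) (by
        intro i hi
        simp only [eval_add, iterate_succ, put_reg, e4]
        simp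
        omega))
    (t' := 6 * h + 6 * r + 8 * T + roundsCost (boostConst p) (fun t => t + 1) (2 ^ h) 1 r +
        roundsCost (boostConst p) (fun t => t * 2) 1 1 h + 44) fun s1 hs1 => ?_)))) (by omega)
    fun _ _ h => h
  obtain ⟨-, a2, a3⟩ := hs1
  have e4 : s1.reg 4 = j := by
    rw [a2]
    simp only [eval_add, iterate_succ, put_reg, e4]
    simp
  have e0 : s1.reg 0 = n := by simp [a3, e0]
  have e1 : s1.reg 1 = k := by simp [a3, e1]
  have e7 : s1.reg 7 = 0 := by simp [a3, e7]
  refine .mono (.block_cons (.arith 1 (by simp) (by omega) (.block_cons (.cons_pure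
    (exec_doublingLoop (by omega) (by omega) (by omega) h _ (by simpa [e4] using hh)
      (by simpa [e4] using hh') (by simp; omega) (by
        intro i hi
        have : ∀ i, (fun t : ℕ => t)^[i] 0 = 0 := fun i => Function.iterate_fixed rfl i
        simp [e7, this]))
    (t' := 6 * r + 8 * T + roundsCost (boostConst p) (fun t => t + 1) (2 ^ h) 1 r +
        roundsCost (boostConst p) (fun t => t * 2) 1 1 h + 36) fun s2 hs2 => ?_)))) (by omega)
    fun _ _ h => h
  obtain ⟨b1, -, b3⟩ := hs2
  have e2 : s2.reg 2 = 2 ^ h := by simp [b1]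
  have e0 : s2.reg 0 = n := by simp [b3, e0]
  have e1 : s2.reg 1 = k := by simp [b3, e1]
  refine .mono (.block_cons (.arith (4 * n) (by simp [e0, mul_comm]) (by omega)
    (.block_cons (.arith k (by simp [e1])
      ((Nat.le_mul_of_pos_right _ (by positivity)).trans_lt hrw)
    (.block_cons (.arith (2 ^ h) (by simp [e2]) (by omega) (.block_cons (.cons_pure
    (exec_doublingLoop (by omega) (by omega) (by omega) r _ (by simpa using hr)
      (by simpa using hr') (by simpa) (by
        intro i hi
        simp only [eval_mul, iterate_double, put_reg, e2]
        simp
        rw [← hT] at hTw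
        exact lt_of_le_of_lt (by gcongr; all_goals omega) hTw))
    (t' := 8 * T + roundsCost (boostConst p) (fun t => t + 1) (2 ^ h) 1 r +
        roundsCost (boostConst p) (fun t => t * 2) 1 1 h + 20) fun s3 hs3 => ?_)))))))) (by omega)
    fun _ _ h => h
  obtain ⟨-, c2, c3⟩ := hs3
  have e2 : s3.reg 2 = T := by
    rw [c2]
    simp only [eval_mul, iterate_double, put_reg, e2]
    simpa
  have e0 : s3.reg 0 = n := by simp [c3, e0]
  have e1 : s3.reg 1 = 2 ^ h := by simp [c3]
  exact .mono (.block_cons (.arith 0 (by simp) (by omega) (.block_cons (.cons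
    (exec_tournament (h := h) (r := r) (by omega) hT hTw hLw _
      (by simpa) (by simpa) (by simpa) (by simp))
      fun i s' hs => .block_nil (.nil hs))))) (by omega) fun _ _ h => h

/-- The program for FT-Min(k) runs in time `O((n / k) log n + (log n) log log n)`. -/
theorem minProgram_solves (p : ℝ) (hp0 : 0 ≤ p) (hp : p < 1 / 2) :
    ∃ (P : Cmd) (c : ℕ) (C : ℝ),
      ∀ (α : Type u) [LinearOrder α] (n k : ℕ) (I : Input α n p), 2 ≤ n → 1 ≤ k → k ≤ n →
        Solves P c I k
          ⌊C * ((n / k : ℝ) * Real.logb 2 n + Real.logb 2 n * Real.logb 2 (Real.logb 2 n))⌋₊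
          ((n : ℝ≥0∞)⁻¹) := by
  refine ⟨minProgram (boostConst p), 128 * boostConst p + 66,
    32 * (64 * boostConst p + 397) + 8 * (16 * boostConst p + 48), ?_⟩
  intro α _ n k I hn hk hkn
  have : NeZero n := ⟨by omega⟩
  have hw := le_two_pow_wordLength (128 * boostConst p + 64) n
  obtain ⟨j, hj, hj'⟩ := exists_least_two_pow_mul one_pos n
  obtain ⟨h, hh, hh'⟩ := exists_least_two_pow_mul one_pos j
  obtain ⟨r, hr, hr'⟩ := exists_least_two_pow_mul hk (4 * n)
  -- Predecessors of the least exponents give the upper bounds: `2 ^ i < n`, `2 ^ h ≤ 2 * (i + 1)`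
  -- and `k * 2 ^ (q + 1) < 8 * n`.
  obtain ⟨i, rfl⟩ : ∃ i, j = i + 1 := Nat.exists_eq_succ_of_ne_zero (by
    rintro rfl
    omega)
  have hi : 2 ^ i < n := by simpa using hj' i (by omega)
  have hi' : i < 2 ^ i := Nat.lt_two_pow_self
  have h2h : 2 ^ h ≤ 2 * (i + 1) := by
    rcases h with _ | g
    · omega
    · have := hh' g (by omega)
      rw [pow_succ]
      omega
  obtain ⟨q, rfl⟩ : ∃ q, r = q + 1 := Nat.exists_eq_succ_of_ne_zero (by
    rintro rfl
    omega)
  have hq : k * 2 ^ (q + 1) < 8 * n := by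
    have := hr' q (by omega)
    rw [pow_succ, ← mul_assoc]
    omega
  have hr1 : q + 1 < 2 ^ (q + 1) := Nat.lt_two_pow_self
  have hh1 : h < 2 ^ h := Nat.lt_two_pow_self
  have hrk : 2 ^ (q + 1) ≤ k * 2 ^ (q + 1) := Nat.le_mul_of_pos_left _ hk
  have hnn : 2 * n ≤ n ^ 2 := by nlinarith
  set T := 2 ^ h * 2 ^ (q + 1) with hT
  have hT16 : T ≤ 16 * n ^ 2 := by
    calc T ≤ (2 * n) * (8 * n) := Nat.mul_le_mul (by omega) (by omega)
      _ = _ := by ring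
  have hTr : 2 ^ (q + 1) ≤ T := Nat.le_mul_of_pos_left _ (by positivity)
  have hTh : 2 ^ h ≤ T := Nat.le_mul_of_pos_right _ (by positivity)
  have hB : boostConst p * T ≤ boostConst p * (16 * n ^ 2) := Nat.mul_le_mul_left _ hT16
  have hexec := exec_minProgram (I := I) (w := wordLength (128 * boostConst p + 66) n)
    hj hj' hh hh' hr hr' hT.symm (lt_of_lt_of_le (by nlinarith) hw)
    (lt_of_lt_of_le (by nlinarith) hw)
    (lt_of_lt_of_le (by rw [pow_succ]; nlinarith) hw)
    (lt_of_lt_of_le (by nlinarith) hw)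
  refine hexec.solves (Nat.le_floor ?_) (loss_champion_two_phase I hp0 hp hkn hr
    (hj.trans (by rw [one_mul]; exact Nat.pow_le_pow_right (by norm_num) (by omega))))
  have c1 := roundsCost_succ_le (boostConst p) (2 ^ h) 1 (q + 1) Nat.one_le_two_pow
  have c2 := roundsCost_double_le (boostConst p) 1 1 h le_rfl le_rfl
  rw [← hT] at c1
  have cost : 6 * (i + 1) + 6 * h + 6 * (q + 1) + 8 * T +
      roundsCost (boostConst p) (fun t => t + 1) (2 ^ h) 1 (q + 1) +
        roundsCost (boostConst p) (fun t => t * 2) 1 1 h + 50 ≤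
      (64 * boostConst p + 397) * T + (16 * boostConst p + 48) * (h * 2 ^ h) := by
    nlinarith
  have hk0 : (0 : ℝ) < k := by exact_mod_cast hk
  have hn0 : (0 : ℝ) < n := by positivity
  have hnk : (1 : ℝ) ≤ n / k := by
    rw [one_le_div hk0]; exact_mod_cast hkn
  have lg1 : 1 ≤ Real.logb 2 n := by
    rw [Real.le_logb_iff_rpow_le (by norm_num) hn0, Real.rpow_one]
    exact_mod_cast hn
  have lgi : (i : ℝ) ≤ Real.logb 2 n := by
    rw [Real.le_logb_iff_rpow_le (by norm_num) hn0, Real.rpow_natCast]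
    exact_mod_cast hi.le
  set l := Real.logb 2 n
  have h2l : (2 : ℝ) ^ h ≤ 4 * l := by
    have : (2 : ℝ) ^ h ≤ 2 * (i + 1) := by exact_mod_cast h2h
    linarith
  have ll0 : 0 ≤ Real.logb 2 l := Real.logb_nonneg (by norm_num) lg1
  have hll : (h : ℝ) ≤ 2 + Real.logb 2 l := by
    rw [← sub_le_iff_le_add', Real.le_logb_iff_rpow_le (by norm_num) (by linarith),
      Real.rpow_sub (by norm_num), Real.rpow_natCast]
    norm_num
    linarith
  have hrnk : (2 : ℝ) ^ (q + 1) ≤ 8 * (n / k) := by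
    rw [← mul_div_assoc, le_div_iff₀ hk0, mul_comm]
    exact_mod_cast hq.le
  have hTl : (T : ℝ) ≤ 32 * (n / k * l) := by
    rw [hT]
    push_cast
    calc (2 : ℝ) ^ h * 2 ^ (q + 1) ≤ (4 * l) * (8 * (n / k)) := by gcongr
      _ = _ := by ring
  -- The term `8 * l` from the additive `2` is charged to `(n / k) * l`, using `n / k ≥ 1`; `l * log
  -- l` alone would not absorb it, as it vanishes for `n = 2`.
  have hhl : (h : ℝ) * 2 ^ h ≤ 8 * (n / k * l) + 4 * (l * Real.logb 2 l) := by
    calc (h : ℝ) * 2 ^ h ≤ (2 + Real.logb 2 l) * (4 * l) := by gcongr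
      _ ≤ _ := by nlinarith
  refine (Nat.cast_le.2 cost).trans ?_
  push_cast
  have hlll : 0 ≤ l * Real.logb 2 l := mul_nonneg (by linarith) ll0
  calc (64 * (boostConst p : ℝ) + 397) * T + (16 * boostConst p + 48) * (h * 2 ^ h)
      ≤ (64 * (boostConst p : ℝ) + 397) * (32 * (n / k * l)) +
        (16 * boostConst p + 48) * (8 * (n / k * l) + 4 * (l * Real.logb 2 l)) := by gcongr
    _ ≤ _ := by
        have : 0 ≤ (boostConst p : ℝ) * (l * Real.logb 2 l) := by positivity
        nlinarith

end Programs

end FTMin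

end

/-- For every fault probability `p < 1/2`:
(1) the winner of the knockout tournament on `n = 2 ^ h` elements is one of the smallest `3n/4`
elements, except with probability at most `2 ^ (-(n + 1))`;
(2) a program simulates the tournament, and so solves FT-Min(3n/4) with this failure probability,
in worst-case time `O(n log n)`;
(3) a program solves FT-Min(k) with probability at least `1 - 1/n` in worst-case time
`O((n/k) log n + (log n) log log n)`, for all `n ≥ 2` and `1 ≤ k ≤ n`. -/
theorem theorem10 (p : ℝ) (hp0 : 0 ≤ p) (hp : p < 1 / 2) :
    (∀ (α : Type u) [LinearOrder α] (h k : ℕ) (I : FTMin.Input α (2 ^ h) p),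
      3 * 2 ^ h ≤ 4 * k →
        (I.knockout h).toOuterMeasure {i | ¬ I.IsSmall k i} ≤ (2⁻¹ : ℝ≥0∞) ^ (2 ^ h + 1)) ∧
    (∃ (P : FTMin.Cmd) (c : ℕ) (C : ℝ),
      ∀ (α : Type u) [LinearOrder α] (n h k : ℕ) (I : FTMin.Input α (2 ^ h) p),
        n = 2 ^ h → 1 ≤ h → 3 * n ≤ 4 * k → k ≤ n →
          FTMin.Solves P c I k ⌊C * (n * Real.logb 2 n)⌋₊ ((2⁻¹ : ℝ≥0∞) ^ (n + 1)) ∧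
          FTMin.outputLaw P c I k ⌊C * (n * Real.logb 2 n)⌋₊ =
            (I.knockout h).map Fin.val) ∧
    (∃ (P : FTMin.Cmd) (c : ℕ) (C : ℝ),
      ∀ (α : Type u) [LinearOrder α] (n k : ℕ) (I : FTMin.Input α n p),
        2 ≤ n → 1 ≤ k → k ≤ n →
          FTMin.Solves P c I k
            ⌊C * ((n / k : ℝ) * Real.logb 2 n + Real.logb 2 n * Real.logb 2 (Real.logb 2 n))⌋₊
            ((n : ℝ≥0∞)⁻¹)) := by
  exact ⟨fun _ _ h k I hk => FTMin.knockout_failure hp0 hp h k I hk,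
    FTMin.knockoutProgram_solves p hp0 hp, FTMin.minProgram_solves p hp0 hp⟩
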